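/- Let $\mathbb{P}=\{1,2,3,\dots\}$ and let $\mathbb{P}^{\pm}$ be the set of nonzero integers, totally ordered by $-1<1<-2<2<-3<3<\cdots$. Work in the ring $\mathbb{C}[[X]]$ of formal power series in $X=\{x_1,x_2,\dots\}$, and fix $q\in\mathbb{C}$. Let $\operatorname{QSym}\subseteq\mathbb{C}[[X]]$ be the algebra of quasisymmetric functions, i.e. of the power series of bounded degree in which, for all $i_1<\dots<i_p$ and all exponents $k_1,\dots,k_p$, the coefficients of $x_{i_1}^{k_1}\cdots x_{i_p}^{k_p}$ and of $x_1^{k_1}\cdots x_p^{k_p}$ are equal. Let $\Lambda\subseteq\operatorname{QSym}$ be the algebra of symmetric functions, and $h_n\in\Lambda$ the complete homogeneous symmetric functions. For a permutation $\pi$ of $[n]=\{1,\dots,n\}$ let $$L^{(q)}_\pi=\sum_{f}\ \prod_{i=1}^{n}q^{[f(i)<0]}\,x_{|f(i)|},$$ where $[f(i)<0]$ is $1$ if $f(i)<0$ and $0$ otherwise, and where the sum is over all maps $f:[n]\to\mathbb{P}^{\pm}$ such that for all $a<b$: if $\pi(a)<\pi(b)$, then $f(\pi(a))<f(\pi(b))$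 or $f(\pi(a))=f(\pi(b))>0$ (as an integer), and if $\pi(a)>\pi(b)$, then $f(\pi(a))<f(\pi(b))$ or $f(\pi(a))=f(\pi(b))<0$ (as an integer). Then $L^{(q)}_\pi\in\operatorname{QSym}$, and it depends only on $n$ and on the descent set $\operatorname{Des}(\pi)=\{i\in[n-1]:\pi(i)>\pi(i+1)\}$; write $L^{(q)}_{n,I}=L^{(q)}_\pi$ if $\operatorname{Des}(\pi)=I\subseteq[n-1]$. The linear span $\mathcal{P}^{(q)}$ of all $L^{(q)}_{n,I}$ ($n\ge 0$, $I\subseteq[n-1]$) is a subalgebra of $\operatorname{QSym}$. For $t\in\mathbb{C}$ let $q_0(X;t)=1$ and, for $n>0$, let $q_n(X;t)\in\Lambda$ be the limit for $k\to\infty$ of $$q_n(x_1,\dots,x_k;t)=(1-t)\sum_{i=1}^{k}x_i^n\prod_{j\ne i}\frac{x_i-tx_j}{x_i-x_j}.$$ Let $\Lambda_t\subseteq\Lambda$ be the subalgebra generated by all $q_n(X;t)$, and let $\theta_t:\Lambda\to\Lambda_t$ be the unique $\mathbb{C}$-algebra homomorphism with $\theta_t(h_n)=q_n(X;t)$ for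 all $n\ge 0$. **Theorem.** There is a $\mathbb{C}$-algebra homomorphism $\Theta_q:\operatorname{QSym}\to\mathcal{P}^{(q)}$ such that $\Theta_q\bigl(L^{(0)}_{n,I}\bigr)=L^{(q)}_{n,I}$ for all $n\geq 0$ and all $I\subseteq[n-1]$. Moreover $\theta_{-q}$ exists and is unique, $\Lambda_{-q}\subseteq\mathcal{P}^{(q)}$, and the restriction of $\Theta_q$ to $\Lambda$ is $\theta_{-q}$; that is, the square formed by $\Theta_q:\operatorname{QSym}\to\mathcal{P}^{(q)}$, $\theta_{-q}:\Lambda\to\Lambda_{-q}$ and the inclusions $\Lambda\subseteq\operatorname{QSym}$ and $\Lambda_{-q}\subseteq\mathcal{P}^{(q)}$ commutes. -/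

import Mathlib

namespace QSymTheta

noncomputable section

open Finset

/-- The ring `ℂ[[X]]` of formal power series in `X = {x₁, x₂, x₃, …}`; the index set is the set
`ℕ+` of positive integers. -/
abbrev PSeries : Type := MvPowerSeries ℕ+ ℂ

/-- Bounded degree: the total degrees of the monomials that occur in `f` are bounded. -/
def HasBoundedDegree (f : PSeries) : Prop :=
  ∃ N : ℕ, ∀ d : ℕ+ →₀ ℕ, MvPowerSeries.coeff d f ≠ 0 → d.degree ≤ N

/-- For all exponents `k₁, …, k_p` and all `i₁ < ⋯ < i_p`, the coefficient of
`x_{i₁}^{k₁} ⋯ x_{i_p}^{k_p}` equals the coefficient of `x₁^{k₁} ⋯ x_p^{k_p}`.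
(The `j`-th entry of `Fin p`, counted from `0`, corresponds to the positive integer `j + 1`.) -/
def IsQuasisymmetric (f : PSeries) : Prop :=
  ∀ (p : ℕ) (k : Fin p → ℕ) (i : Fin p → ℕ+), StrictMono i →
    MvPowerSeries.coeff (∑ j, Finsupp.single (i j) (k j)) f =
      MvPowerSeries.coeff (∑ j : Fin p, Finsupp.single (Nat.succPNat (j : ℕ)) (k j)) f

/-- Invariance under all permutations of the variables. -/
def IsSymmetric (f : PSeries) : Prop :=
  ∀ (s : Equiv.Perm ℕ+) (d : ℕ+ →₀ ℕ),
    MvPowerSeries.coeff (d.mapDomain s) f = MvPowerSeries.coeff d f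

/-! Closure properties -/

theorem HasBoundedDegree.add {f g : PSeries} (hf : HasBoundedDegree f)
    (hg : HasBoundedDegree g) : HasBoundedDegree (f + g) := by
  obtain ⟨M, hM⟩ := hf
  obtain ⟨N, hN⟩ := hg
  refine ⟨max M N, fun d hd => ?_⟩
  by_contra h
  rw [not_le, max_lt_iff] at h
  apply hd
  rw [map_add]
  have h1 : MvPowerSeries.coeff d f = 0 := by
    by_contra h'
    exact absurd (hM d h') (not_le.mpr h.1)
  have h2 : MvPowerSeries.coeff d g = 0 := by
    by_contra h'
    exact absurd (hN d h') (not_le.mpr h.2)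
  rw [h1, h2, add_zero]

theorem HasBoundedDegree.mul {f g : PSeries} (hf : HasBoundedDegree f)
    (hg : HasBoundedDegree g) : HasBoundedDegree (f * g) := by
  obtain ⟨M, hM⟩ := hf
  obtain ⟨N, hN⟩ := hg
  refine ⟨M + N, fun d hd => ?_⟩
  rw [MvPowerSeries.coeff_mul] at hd
  obtain ⟨⟨a, b⟩, hab, hne⟩ := Finset.exists_ne_zero_of_sum_ne_zero hd
  rw [HasAntidiagonal.mem_antidiagonal] at hab
  have ha := hM a (left_ne_zero_of_mul hne)
  have hb := hN b (right_ne_zero_of_mul hne)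
  simp only at hab
  rw [← hab, map_add]
  omega

theorem HasBoundedDegree.algebraMap (c : ℂ) :
    HasBoundedDegree (algebraMap ℂ PSeries c) := by
  classical
  refine ⟨0, fun d hd => ?_⟩
  rw [MvPowerSeries.algebraMap_apply, MvPowerSeries.coeff_C] at hd
  have : d = 0 := by
    by_contra h
    simp [h] at hd
  simp [this]

theorem sum_single_eq_embDomain {p : ℕ} (i : Fin p ↪ ℕ+) (k : Fin p → ℕ) :
    (∑ j, Finsupp.single (i j) (k j)) =
      Finsupp.embDomain i (Finsupp.equivFunOnFinite.symm k) := by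
  rw [Finsupp.embDomain_eq_mapDomain]
  conv_rhs => rw [← Finsupp.univ_sum_single (Finsupp.equivFunOnFinite.symm k)]
  rw [Finsupp.mapDomain_finsetSum]
  simp [Finsupp.mapDomain_single]

/-- The embedding of `{1, …, k}` into the positive integers. -/
def firstVars (k : ℕ) : Fin k ↪ ℕ+ where
  toFun j := Nat.succPNat j
  inj' a b h := by
    have := Nat.succPNat_injective h
    exact Fin.ext this

theorem firstVars_strictMono (k : ℕ) : StrictMono (firstVars k) := by
  intro a b h
  exact Nat.succPNat_lt_succPNat.mpr h

theorem isQuasisymmetric_iff (f : PSeries) :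
    IsQuasisymmetric f ↔ ∀ (p : ℕ) (i : Fin p ↪ ℕ+), StrictMono i →
      MvPowerSeries.killCompl (R := ℂ) i f = MvPowerSeries.killCompl (R := ℂ) (firstVars p) f := by
  constructor
  · intro h p i hi
    ext d
    rw [MvPowerSeries.coeff_killCompl, MvPowerSeries.coeff_killCompl]
    have h1 := h p (Finsupp.equivFunOnFinite d) i hi
    have h2 := sum_single_eq_embDomain i (Finsupp.equivFunOnFinite d)
    have h3 := sum_single_eq_embDomain (firstVars p) (Finsupp.equivFunOnFinite d)
    rw [Equiv.symm_apply_apply] at h2 h3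
    rw [← h2, ← h3]
    exact h1
  · intro h p k i hi
    have h1 := h p ⟨i, hi.injective⟩ hi
    have h2 := sum_single_eq_embDomain ⟨i, hi.injective⟩ k
    have h3 := sum_single_eq_embDomain (firstVars p) k
    have h4 := congrArg (MvPowerSeries.coeff (Finsupp.equivFunOnFinite.symm k)) h1
    rw [MvPowerSeries.coeff_killCompl, MvPowerSeries.coeff_killCompl, ← h2, ← h3] at h4
    exact h4

theorem isSymmetric_iff (f : PSeries) :
    IsSymmetric f ↔ ∀ s : Equiv.Perm ℕ+,
      MvPowerSeries.killCompl (R := ℂ) s.toEmbedding f = f := by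
  constructor
  · intro h s
    ext d
    rw [MvPowerSeries.coeff_killCompl, Finsupp.embDomain_eq_mapDomain]
    exact h s d
  · intro h s d
    conv_rhs => rw [← h s]
    rw [MvPowerSeries.coeff_killCompl, Finsupp.embDomain_eq_mapDomain]
    rfl

/-- The ring `QSym` of quasisymmetric functions over `ℂ`. -/
def QSym : Subalgebra ℂ PSeries where
  carrier := {f | HasBoundedDegree f ∧ IsQuasisymmetric f}
  mul_mem' := by
    rintro f g ⟨hf, hf'⟩ ⟨hg, hg'⟩
    refine ⟨hf.mul hg, ?_⟩
    rw [isQuasisymmetric_iff] at *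
    intro p i hi
    rw [map_mul, map_mul, hf' p i hi, hg' p i hi]
  add_mem' := by
    rintro f g ⟨hf, hf'⟩ ⟨hg, hg'⟩
    refine ⟨hf.add hg, ?_⟩
    rw [isQuasisymmetric_iff] at *
    intro p i hi
    rw [map_add, map_add, hf' p i hi, hg' p i hi]
  algebraMap_mem' c := by
    refine ⟨HasBoundedDegree.algebraMap c, ?_⟩
    rw [isQuasisymmetric_iff]
    intro p i hi
    rw [AlgHom.commutes, AlgHom.commutes]

/-- The ring `Λ` of symmetric functions over `ℂ`. -/
def Sym : Subalgebra ℂ PSeries where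
  carrier := {f | HasBoundedDegree f ∧ IsSymmetric f}
  mul_mem' := by
    rintro f g ⟨hf, hf'⟩ ⟨hg, hg'⟩
    refine ⟨hf.mul hg, ?_⟩
    rw [isSymmetric_iff] at *
    intro s
    rw [map_mul, hf' s, hg' s]
  add_mem' := by
    rintro f g ⟨hf, hf'⟩ ⟨hg, hg'⟩
    refine ⟨hf.add hg, ?_⟩
    rw [isSymmetric_iff] at *
    intro s
    rw [map_add, hf' s, hg' s]
  algebraMap_mem' c := by
    refine ⟨HasBoundedDegree.algebraMap c, ?_⟩
    rw [isSymmetric_iff]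
    intro s
    rw [AlgHom.commutes]

/-- Every symmetric function is quasisymmetric. -/
theorem sym_le_qsym : Sym ≤ QSym := by
  classical
  rintro f ⟨hf, hf'⟩
  refine ⟨hf, fun p k i hi => ?_⟩
  let e : {x // x ∈ Set.range (firstVars p)} ≃ {x // x ∈ Set.range i} :=
    (Equiv.ofInjective _ (firstVars p).injective).symm.trans (Equiv.ofInjective _ hi.injective)
  have : Finite {x // x ∈ Set.range (firstVars p)} := Set.finite_range _
  obtain ⟨s, hs⟩ : ∃ s : Equiv.Perm ℕ+, ∀ j, s (firstVars p j) = i j := by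
    have h1 : Nonempty (((Set.range (firstVars p))ᶜ : Set ℕ+) ≃ ((Set.range i)ᶜ : Set ℕ+)) := by
      have : Infinite ((Set.range (firstVars p))ᶜ : Set ℕ+) :=
        (Set.finite_range _).infinite_compl.to_subtype
      have : Infinite ((Set.range i)ᶜ : Set ℕ+) :=
        (Set.finite_range _).infinite_compl.to_subtype
      exact nonempty_equiv_of_countable
    obtain ⟨e'⟩ := h1
    refine ⟨Equiv.subtypeCongr e e', fun j => ?_⟩
    have hj : firstVars p j ∈ Set.range (firstVars p) := ⟨j, rfl⟩
    simp only [Equiv.subtypeCongr, Equiv.trans_apply]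
    rw [Equiv.sumCompl_symm_apply_of_pos hj]
    simp only [Equiv.sumCongr_apply, Sum.map_inl, Equiv.sumCompl_apply_inl]
    have : (Equiv.ofInjective _ (firstVars p).injective).symm ⟨firstVars p j, hj⟩ = j := by
      rw [Equiv.symm_apply_eq]
      rfl
    simp [e, this]
  rw [← hf' s (∑ j : Fin p, Finsupp.single (Nat.succPNat (j : ℕ)) (k j)), Finsupp.mapDomain_finsetSum]
  congr 2
  refine Finset.sum_congr rfl fun j _ => ?_
  rw [Finsupp.mapDomain_single]
  congr 1
  exact (hs j).symm

/-- The complete homogeneous symmetric function `h_n`: the sum of all monomials of degree `n`. -/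
def hsymm (n : ℕ) : PSeries := fun d => if d.degree = n then 1 else 0

theorem coeff_hsymm (n : ℕ) (d : ℕ+ →₀ ℕ) :
    MvPowerSeries.coeff d (hsymm n) = if d.degree = n then 1 else 0 := rfl

theorem hsymm_mem (n : ℕ) : hsymm n ∈ Sym := by
  refine ⟨⟨n, fun d hd => ?_⟩, fun s d => ?_⟩
  · by_contra h
    apply hd
    rw [coeff_hsymm, if_neg (by omega)]
  · rw [coeff_hsymm, coeff_hsymm, Finsupp.degree_mapDomain]

/-! Enriched `P`-partitions -/

/-- A labelled weighted poset `([n], <_P, ε)`; the label `i + 1 ∈ [n]` is represented by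
`i : Fin n`. -/
structure LabelledWeightedPoset (n : ℕ) where
  lt : Fin n → Fin n → Prop
  irrefl : ∀ i, ¬ lt i i
  trans : ∀ i j k, lt i j → lt j k → lt i k
  weight : Fin n → ℕ+

/-- The set of positive and negative integers, ordered by `-1 < 1 < -2 < 2 < -3 < 3 < ⋯`.
The integer `m` is represented by `(|m|, decide (0 < m))`, and the order is lexicographic, with
`false < true`. -/
abbrev SignedPos : Type := ℕ+ ×ₗ Bool

/-- The absolute value. -/
def SignedPos.abs (z : SignedPos) : ℕ+ := (ofLex z).1

/-- The element is positive. -/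
def SignedPos.IsPos (z : SignedPos) : Prop := (ofLex z).2 = true

/-- The element is negative. -/
def SignedPos.IsNeg (z : SignedPos) : Prop := (ofLex z).2 = false

instance (z : SignedPos) : Decidable z.IsNeg := inferInstanceAs (Decidable (_ = _))

/-- Enriched `P`-partitions `f : [n] → {±1, ±2, …}`. -/
def IsEnriched {n : ℕ} (P : LabelledWeightedPoset n) (f : Fin n → SignedPos) : Prop :=
  (∀ i j, P.lt i j → i < j → f i < f j ∨ (f i = f j ∧ (f i).IsPos)) ∧
  (∀ i j, P.lt i j → j < i → f i < f j ∨ (f i = f j ∧ (f i).IsNeg))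

/-- The exponent of the monomial `∏ i, x_{|f i|} ^ ε(i)`. -/
def content {n : ℕ} (P : LabelledWeightedPoset n) (f : Fin n → SignedPos) : ℕ+ →₀ ℕ :=
  ∑ i, Finsupp.single (f i).abs (P.weight i : ℕ)

theorem finite_enriched {n : ℕ} (P : LabelledWeightedPoset n) (d : ℕ+ →₀ ℕ) :
    {f : Fin n → SignedPos | IsEnriched P f ∧ content P f = d}.Finite := by
  have hfin : (Set.univ.pi fun _ : Fin n =>
      {z : SignedPos | z.abs ∈ d.support}).Finite := by
    refine Set.Finite.pi fun _ => ?_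
    have : {z : SignedPos | z.abs ∈ d.support} ⊆
        (fun z : ℕ+ × Bool => toLex z) '' ((d.support : Set ℕ+) ×ˢ Set.univ) := by
      intro z hz
      exact ⟨ofLex z, ⟨hz, trivial⟩, rfl⟩
    exact Set.Finite.subset (((d.support.finite_toSet).prod Set.finite_univ).image _) this
  refine hfin.subset ?_
  rintro f ⟨-, rfl⟩ i -
  simp only [Set.mem_ofPred_eq, Finsupp.mem_support_iff, content, Finsupp.coe_finsetSum,
    Finset.sum_apply]
  intro h0
  have := (Finset.sum_eq_zero_iff.mp h0) i (Finset.mem_univ i)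
  simp at this

/-- The `q`-deformed generating function
`Γ^{(q)}([n], <_P, ε) = ∑_f ∏_i q^{[f(i) < 0]} x_{|f(i)|}^{ε(i)}`, the sum being over all enriched
`P`-partitions `f`: the coefficient of a monomial is the sum of the weights `∏_i q^{[f(i) < 0]}` of
the finitely many `f` that contribute to this monomial. -/
def Gamma (q : ℂ) {n : ℕ} (P : LabelledWeightedPoset n) : PSeries := fun d =>
  ∑ f ∈ (finite_enriched P d).toFinset, ∏ i, (if (f i).IsNeg then q else 1)

theorem coeff_Gamma (q : ℂ) {n : ℕ} (P : LabelledWeightedPoset n) (d : ℕ+ →₀ ℕ) :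
    MvPowerSeries.coeff d (Gamma q P) =
      ∑ f ∈ (finite_enriched P d).toFinset, ∏ i, (if (f i).IsNeg then q else 1) := rfl

/-- The chain `P_π`, in which `π_i <_π π_j` if and only if `i < j`, with all weights `1`. -/
def chainPoset {n : ℕ} (π : Equiv.Perm (Fin n)) : LabelledWeightedPoset n where
  lt a b := π.symm a < π.symm b
  irrefl _ := lt_irrefl _
  trans _ _ _ := lt_trans
  weight _ := 1

/-- The `q`-fundamental quasisymmetric function `L_π^{(q)}`. -/
def permFundamental (q : ℂ) {n : ℕ} (π : Equiv.Perm (Fin n)) : PSeries := Gamma q (chainPoset π)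

/-- The element `i` of `[n-1]` is represented by `i - 1 : Fin (n - 1)`. This is the position `i`. -/
def pos {n : ℕ} (i : Fin (n - 1)) : Fin n := ⟨i, by omega⟩

/-- The position `i + 1`, for `i` in `[n-1]`. -/
def nextPos {n : ℕ} (i : Fin (n - 1)) : Fin n := ⟨i + 1, by omega⟩

/-- The descent set `Des(π) = {i ∈ [n-1] ∣ π(i) > π(i+1)}`. -/
def descents {n : ℕ} (π : Equiv.Perm (Fin n)) : Finset (Fin (n - 1)) :=
  {i | π (nextPos i) < π (pos i)}

/-- Every subset of `[n-1]` is the descent set of a permutation. -/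
theorem exists_descents_eq (n : ℕ) (I : Finset (Fin (n - 1))) :
    ∃ π : Equiv.Perm (Fin n), descents π = I := by
  classical
  let f : Fin n → ℕ := fun a => #{j ∈ I | a ≤ pos j}
  refine ⟨(Tuple.graphEquiv₁ f).trans (Tuple.graphEquiv₂ f).toEquiv.symm, ?_⟩
  ext i
  have h1 : ((Tuple.graphEquiv₁ f).trans (Tuple.graphEquiv₂ f).toEquiv.symm) (nextPos i) <
      ((Tuple.graphEquiv₁ f).trans (Tuple.graphEquiv₂ f).toEquiv.symm) (pos i) ↔
      toLex (f (nextPos i), nextPos i) < toLex (f (pos i), pos i) :=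
    (Tuple.graphEquiv₂ f).symm.lt_iff_lt
  simp only [descents, mem_filter, mem_univ, true_and]
  rw [h1, Prod.Lex.toLex_lt_toLex]
  have h2 : pos i < nextPos i := Fin.mk_lt_mk.mpr (Nat.lt_succ_self _)
  have hsub : ({j ∈ I | nextPos i ≤ pos j} : Finset _) ⊆ {j ∈ I | pos i ≤ pos j} := by
    intro j hj
    rw [mem_filter] at hj ⊢
    exact ⟨hj.1, h2.le.trans hj.2⟩
  constructor
  · rintro (h | h)
    · by_contra hi
      refine absurd h (not_lt.mpr (Finset.card_le_card fun j hj => ?_))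
      rw [mem_filter] at hj ⊢
      refine ⟨hj.1, ?_⟩
      have : i ≠ j := fun hij => hi (hij ▸ hj.1)
      have h3 := hj.2
      simp only [pos, nextPos, Fin.mk_le_mk] at h3 ⊢
      have : (i : ℕ) ≠ j := fun h => this (Fin.ext h)
      omega
    · exact absurd h.2 (not_lt.mpr h2.le)
  · intro hi
    left
    refine Finset.card_lt_card ⟨hsub, fun h => ?_⟩
    have : i ∈ ({j ∈ I | nextPos i ≤ pos j} : Finset _) := h (mem_filter.mpr ⟨hi, le_rfl⟩)
    exact absurd (mem_filter.mp this).2 (not_le.mpr h2)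

/-- The `q`-fundamental quasisymmetric function `L_{n,I}^{(q)}`, for `I ⊆ [n-1]`: it is `L_π^{(q)}`
for a permutation `π` of `[n]` with descent set `I`. -/
def fundamental (q : ℂ) (n : ℕ) (I : Finset (Fin (n - 1))) : PSeries :=
  permFundamental q (exists_descents_eq n I).choose

theorem hasBoundedDegree_Gamma (q : ℂ) {n : ℕ} (P : LabelledWeightedPoset n) :
    HasBoundedDegree (Gamma q P) := by
  refine ⟨∑ i, (P.weight i : ℕ), fun d hd => ?_⟩
  rw [coeff_Gamma] at hd
  obtain ⟨f, hf, -⟩ := Finset.exists_ne_zero_of_sum_ne_zero hd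
  rw [Set.Finite.mem_toFinset] at hf
  rw [← hf.2, content, map_sum]
  refine (Finset.sum_congr rfl fun i _ => ?_).le
  simp

theorem isQuasisymmetric_Gamma (q : ℂ) {n : ℕ} (P : LabelledWeightedPoset n) :
    IsQuasisymmetric (Gamma q P) := by
  classical
  -- the renaming of the entries along a map of the absolute values
  let R : (ℕ+ → ℕ+) → (Fin n → SignedPos) → Fin n → SignedPos :=
    fun φ f a => toLex (φ (f a).abs, (ofLex (f a)).2)
  have hneg : ∀ φ f a, (R φ f a).IsNeg ↔ (f a).IsNeg := fun _ _ _ => Iff.rfl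
  have habs : ∀ φ f a, (R φ f a).abs = φ (f a).abs := fun _ _ _ => rfl
  have hcont : ∀ φ f, content P (R φ f) = (content P f).mapDomain φ := by
    intro φ f
    simp only [content, Finsupp.mapDomain_finsetSum, Finsupp.mapDomain_single, habs]
  have hmem : ∀ f a, (f a).abs ∈ (content P f).support := by
    intro f a
    simp only [Finsupp.mem_support_iff, content, Finsupp.coe_finsetSum, Finset.sum_apply]
    intro h0
    have := (Finset.sum_eq_zero_iff.mp h0) a (Finset.mem_univ a)
    simp at this
  have hlt : ∀ φ f, StrictMonoOn φ (content P f).support → ∀ a b,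
      f a < f b → R φ f a < R φ f b := by
    intro φ f hφ a b hab
    rw [Prod.Lex.lt_iff] at hab ⊢
    rcases hab with h | ⟨h, h'⟩
    · exact Or.inl (hφ (hmem f a) (hmem f b) h)
    · exact Or.inr ⟨congrArg φ h, h'⟩
  have henr : ∀ φ f, StrictMonoOn φ (content P f).support → IsEnriched P f →
      IsEnriched P (R φ f) := by
    intro φ f hφ hf
    refine ⟨fun a b h1 h2 => ?_, fun a b h1 h2 => ?_⟩
    · rcases hf.1 a b h1 h2 with h | ⟨h, h'⟩
      · exact Or.inl (hlt φ f hφ a b h)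
      · exact Or.inr ⟨by simp only [R, h], h'⟩
    · rcases hf.2 a b h1 h2 with h | ⟨h, h'⟩
      · exact Or.inl (hlt φ f hφ a b h)
      · exact Or.inr ⟨by simp only [R, h], h'⟩
  intro p k i hi
  let φ : ℕ+ → ℕ+ := fun x => if h : ∃ j, i j = x then firstVars p h.choose else 1
  let ψ : ℕ+ → ℕ+ := fun x => if h : ∃ j, firstVars p j = x then i h.choose else 1
  have hφ : ∀ j, φ (i j) = firstVars p j := by
    intro j
    have h : ∃ j', i j' = i j := ⟨j, rfl⟩
    simp only [φ, dif_pos h]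
    rw [hi.injective h.choose_spec]
  have hψ : ∀ j, ψ (firstVars p j) = i j := by
    intro j
    have h : ∃ j', firstVars p j' = firstVars p j := ⟨j, rfl⟩
    simp only [ψ, dif_pos h]
    rw [(firstVars p).injective h.choose_spec]
  have hsupp : ∀ (v : Fin p → ℕ+) x, x ∈ (∑ j, Finsupp.single (v j) (k j)).support →
      ∃ j, v j = x := by
    intro v x hx
    have := Finsupp.support_finsetSum hx
    rw [Finset.mem_biUnion] at this
    obtain ⟨j, -, hj⟩ := this
    exact ⟨j, (Finset.mem_singleton.mp (Finsupp.support_single_subset hj)).symm⟩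
  set d := ∑ j, Finsupp.single (i j) (k j) with hd
  have hd' : (∑ j : Fin p, Finsupp.single (Nat.succPNat (j : ℕ)) (k j)) =
      ∑ j, Finsupp.single (firstVars p j) (k j) := rfl
  rw [hd']
  set d' := ∑ j, Finsupp.single (firstVars p j) (k j) with hdd'
  have hφd : d.mapDomain φ = d' := by
    simp only [hd, hdd', Finsupp.mapDomain_finsetSum, Finsupp.mapDomain_single, hφ]
  have hψd : d'.mapDomain ψ = d := by
    simp only [hd, hdd', Finsupp.mapDomain_finsetSum, Finsupp.mapDomain_single, hψ]
  have hφm : StrictMonoOn φ d.support := by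
    intro x hx y hy hxy
    obtain ⟨a, rfl⟩ := hsupp i x hx
    obtain ⟨b, rfl⟩ := hsupp i y hy
    rw [hφ, hφ]
    exact firstVars_strictMono p (hi.lt_iff_lt.mp hxy)
  have hψm : StrictMonoOn ψ d'.support := by
    intro x hx y hy hxy
    obtain ⟨a, rfl⟩ := hsupp _ x hx
    obtain ⟨b, rfl⟩ := hsupp _ y hy
    rw [hψ, hψ]
    exact hi ((firstVars_strictMono p).lt_iff_lt.mp hxy)
  rw [coeff_Gamma, coeff_Gamma]
  refine Finset.sum_bij' (fun f _ => R φ f) (fun f _ => R ψ f) ?_ ?_ ?_ ?_ ?_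
  · intro f hf
    rw [Set.Finite.mem_toFinset] at hf ⊢
    exact ⟨henr φ f (hf.2 ▸ hφm) hf.1, by rw [hcont, hf.2, hφd]⟩
  · intro f hf
    rw [Set.Finite.mem_toFinset] at hf ⊢
    exact ⟨henr ψ f (hf.2 ▸ hψm) hf.1, by rw [hcont, hf.2, hψd]⟩
  · intro f hf
    rw [Set.Finite.mem_toFinset] at hf
    funext a
    obtain ⟨j, hj⟩ := hsupp i _ (hf.2 ▸ hmem f a)
    have : ψ (φ (f a).abs) = (f a).abs := by rw [← hj, hφ, hψ]
    exact congrArg (fun x => toLex (x, (ofLex (f a)).2)) this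
  · intro f hf
    rw [Set.Finite.mem_toFinset] at hf
    funext a
    obtain ⟨j, hj⟩ := hsupp _ _ (hf.2 ▸ hmem f a)
    have : φ (ψ (f a).abs) = (f a).abs := by rw [← hj, hψ, hφ]
    exact congrArg (fun x => toLex (x, (ofLex (f a)).2)) this
  · intro f hf
    rfl

theorem fundamental_mem_qsym (q : ℂ) (n : ℕ) (I : Finset (Fin (n - 1))) :
    fundamental q n I ∈ QSym :=
  ⟨hasBoundedDegree_Gamma q _, isQuasisymmetric_Gamma q _⟩

/-- The set of all `L_{n,I}^{(q)}`, for `n ≥ 0` and `I ⊆ [n-1]`. -/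
def fundamentals (q : ℂ) : Set PSeries :=
  {f | ∃ (n : ℕ) (I : Finset (Fin (n - 1))), f = fundamental q n I}

/-- The subalgebra `𝒫^{(q)}` generated by all `L_{n,I}^{(q)}`. (It coincides with their
linear span.) -/
def fundamentalAlgebra (q : ℂ) : Subalgebra ℂ PSeries := Algebra.adjoin ℂ (fundamentals q)

theorem fundamental_mem (q : ℂ) (n : ℕ) (I : Finset (Fin (n - 1))) :
    fundamental q n I ∈ fundamentalAlgebra q :=
  Algebra.subset_adjoin ⟨n, I, rfl⟩

theorem fundamentalAlgebra_le_qsym (q : ℂ) : fundamentalAlgebra q ≤ QSym := by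
  refine Algebra.adjoin_le ?_
  rintro f ⟨n, I, rfl⟩
  exact fundamental_mem_qsym q n I

/-! The functions `q_n(X; t)` -/

/-- The rational function
`q_n(x₁, …, x_k; t) = (1 - t) ∑ᵢ xᵢⁿ ∏_{j ≠ i} (xᵢ - t xⱼ) / (xᵢ - xⱼ)`, for `n > 0`. -/
def hallLittlewoodRat (t : ℂ) (n k : ℕ) : FractionRing (MvPolynomial (Fin k) ℂ) :=
  let x : Fin k → FractionRing (MvPolynomial (Fin k) ℂ) := fun i =>
    algebraMap (MvPolynomial (Fin k) ℂ) _ (MvPolynomial.X i)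
  let c : FractionRing (MvPolynomial (Fin k) ℂ) :=
    algebraMap (MvPolynomial (Fin k) ℂ) _ (MvPolynomial.C t)
  (1 - c) * ∑ i, x i ^ n * ∏ j ∈ univ.erase i, (x i - c * x j) / (x i - x j)

/-- `F` is the limit of `q_n(x₁, …, x_k; t)` for `k → ∞`: for every `k`, setting
`x_{k+1} = x_{k+2} = ⋯ = 0` in `F` gives a polynomial, which is `q_n(x₁, …, x_k; t)`. -/
def IsHallLittlewood (t : ℂ) (n : ℕ) (F : PSeries) : Prop :=
  ∀ k : ℕ, ∃ p : MvPolynomial (Fin k) ℂ,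
    (∀ d : Fin k →₀ ℕ, p.coeff d = MvPowerSeries.coeff (d.mapDomain (firstVars k)) F) ∧
    algebraMap (MvPolynomial (Fin k) ℂ) (FractionRing (MvPolynomial (Fin k) ℂ)) p =
      hallLittlewoodRat t n k

section Existence

variable {K : Type*} [Field K] {ι : Type*} [DecidableEq ι]

/-- The factor `(1 - t y u) / (1 - y u)` as a power series in `u`. -/
def factor (t y : K) : PowerSeries K :=
  PowerSeries.mk fun m => if m = 0 then 1 else (1 - t) * y ^ m

theorem factor_mul (t y : K) (G : PowerSeries K) (n : ℕ) :
    PowerSeries.coeff (n + 1) (factor t y * G) - y * PowerSeries.coeff n (factor t y * G) =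
      PowerSeries.coeff (n + 1) G - t * y * PowerSeries.coeff n G := by
  have h : (1 - PowerSeries.C y * PowerSeries.X) * factor t y =
      1 - PowerSeries.C (t * y) * PowerSeries.X := by
    ext m
    rw [sub_mul, one_mul, mul_assoc, map_sub, map_sub, PowerSeries.coeff_C_mul,
      PowerSeries.coeff_C_mul]
    rcases m with _ | m
    · simp [factor]
    · rw [PowerSeries.coeff_succ_X_mul]
      rcases m with _ | m
      · simp [factor, PowerSeries.coeff_X, PowerSeries.coeff_one]
        ring
      · simp [factor, PowerSeries.coeff_X, PowerSeries.coeff_one]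
        ring
  have h2 := congrArg (fun z => PowerSeries.coeff (n + 1) (z * G)) h
  rw [mul_assoc, sub_mul, sub_mul, one_mul, one_mul, mul_assoc, mul_assoc, map_sub, map_sub,
    PowerSeries.coeff_C_mul, PowerSeries.coeff_C_mul, PowerSeries.coeff_succ_X_mul,
    PowerSeries.coeff_succ_X_mul] at h2
  exact h2

/-- The rational expression for `q_n`, over a general field. -/
def ratSum (t : K) (v : ι → K) (S : Finset ι) (n : ℕ) : K :=
  (1 - t) * ∑ i ∈ S, v i ^ n * ∏ j ∈ S.erase i, (v i - t * v j) / (v i - v j)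

theorem ratSum_zero (t : K) (v : ι → K) (hv : Function.Injective v) (hv0 : ∀ i, v i ≠ 0)
    (S : Finset ι) : ratSum t v S 0 = 1 - t ^ #S := by
  rcases S.eq_empty_or_nonempty with rfl | hS
  · simp [ratSum]
  let A : Polynomial K := ∏ j ∈ S, (Polynomial.X - Polynomial.C (t * v j))
  let B : Polynomial K := ∏ j ∈ S, (Polynomial.X - Polynomial.C (v j))
  let g : Polynomial K := A - Polynomial.C (t ^ #S) * B
  have hA : A.Monic := Polynomial.monic_prod_X_sub_C _ _
  have hB : B.Monic := Polynomial.monic_prod_X_sub_C _ _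
  have hAd : A.natDegree = #S := Polynomial.natDegree_finsetProd_X_sub_C_eq_card _ _
  have hBd : B.natDegree = #S := Polynomial.natDegree_finsetProd_X_sub_C_eq_card _ _
  have hg0 : g.coeff 0 = 0 := by
    simp only [g, A, B, Polynomial.coeff_zero_eq_eval_zero, Polynomial.eval_sub,
      Polynomial.eval_mul, Polynomial.eval_C, Polynomial.eval_prod, Polynomial.eval_X, zero_sub]
    rw [← Finset.prod_const, ← Finset.prod_mul_distrib, sub_eq_zero]
    exact Finset.prod_congr rfl fun j _ => by ring
  have hgX : Polynomial.X * g.divX = g := by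
    conv_rhs => rw [← Polynomial.divX_mul_X_add g, hg0]
    simp [mul_comm]
  have hgd : g.natDegree ≤ #S := by
    refine (Polynomial.natDegree_sub_le _ _).trans (max_le hAd.le ?_)
    exact (Polynomial.natDegree_C_mul_le _ _).trans hBd.le
  have hpos : 0 < #S := hS.card_pos
  have hfd : g.divX.degree < #S := by
    refine (Polynomial.degree_le_natDegree).trans_lt ?_
    rw [Polynomial.natDegree_divX_eq_natDegree_tsub_one]
    exact_mod_cast (by omega : g.natDegree - 1 < #S)
  have hL := Lagrange.coeff_eq_sum (hv.injOn (s := (S : Set ι))) hfd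
  rw [Polynomial.coeff_divX, Nat.sub_add_cancel hpos] at hL
  have hcoef : g.coeff #S = 1 - t ^ #S := by
    have h1 : A.coeff #S = 1 := by rw [← hAd]; exact hA
    have h2 : B.coeff #S = 1 := by rw [← hBd]; exact hB
    simp only [g, Polynomial.coeff_sub, Polynomial.coeff_C_mul, h1, h2, mul_one]
  rw [hcoef] at hL
  rw [hL, ratSum, Finset.mul_sum]
  refine Finset.sum_congr rfl fun i hi => ?_
  have he : v i * g.divX.eval (v i) = v i * ((1 - t) * ∏ j ∈ S.erase i, (v i - t * v j)) := by
    have := congrArg (Polynomial.eval (v i)) hgX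
    rw [Polynomial.eval_mul, Polynomial.eval_X] at this
    rw [this]
    have hB0 : B.eval (v i) = 0 := by
      simp only [B, Polynomial.eval_prod]
      exact Finset.prod_eq_zero hi (by simp)
    simp only [g, Polynomial.eval_sub, Polynomial.eval_mul, hB0, mul_zero, sub_zero]
    simp only [A, Polynomial.eval_prod, Polynomial.eval_sub, Polynomial.eval_X, Polynomial.eval_C]
    rw [← Finset.mul_prod_erase S _ hi]
    ring
  rw [mul_left_cancel₀ (hv0 i) he, pow_zero, one_mul, Finset.prod_div_distrib, mul_div_assoc]

theorem ratSum_insert (t : K) (v : ι → K) (hv : Function.Injective v) (S : Finset ι) (y : ι)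
    (hy : y ∉ S) (n : ℕ) :
    ratSum t v (insert y S) (n + 1) - v y * ratSum t v (insert y S) n =
      ratSum t v S (n + 1) - t * v y * ratSum t v S n := by
  have key : ∀ m, ratSum t v (insert y S) m = (1 - t) * (v y ^ m * ∏ j ∈ S,
      (v y - t * v j) / (v y - v j)) + (1 - t) * ∑ i ∈ S, v i ^ m *
        ((v i - t * v y) / (v i - v y) * ∏ j ∈ S.erase i, (v i - t * v j) / (v i - v j)) := by
    intro m
    rw [ratSum, Finset.sum_insert hy, Finset.erase_insert hy, mul_add]
    congr 2
    refine Finset.sum_congr rfl fun i hi => ?_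
    have hne : y ≠ i := fun h => hy (h ▸ hi)
    rw [Finset.erase_insert_of_ne hne, Finset.prod_insert (fun h => hy (Finset.mem_of_mem_erase h))]
  rw [key, key, ratSum, ratSum]
  have : ∀ i ∈ S, v i ^ (n + 1) * ((v i - t * v y) / (v i - v y) *
      ∏ j ∈ S.erase i, (v i - t * v j) / (v i - v j)) =
      v y * (v i ^ n * ((v i - t * v y) / (v i - v y) *
      ∏ j ∈ S.erase i, (v i - t * v j) / (v i - v j))) +
      (v i ^ (n + 1) * (∏ j ∈ S.erase i, (v i - t * v j) / (v i - v j)) -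
        t * v y * (v i ^ n * ∏ j ∈ S.erase i, (v i - t * v j) / (v i - v j))) := by
    intro i hi
    have hne : v i - v y ≠ 0 := sub_ne_zero.mpr fun h => hy (hv h ▸ hi)
    field_simp
    ring
  rw [Finset.sum_congr rfl this, Finset.sum_add_distrib, Finset.sum_sub_distrib,
    ← Finset.mul_sum, ← Finset.mul_sum]
  ring

theorem coeff_prod_factor (t : K) (v : ι → K) (hv : Function.Injective v) (hv0 : ∀ i, v i ≠ 0)
    (S : Finset ι) (n : ℕ) :
    PowerSeries.coeff (n + 1) (∏ i ∈ S, factor t (v i)) = ratSum t v S (n + 1) := by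
  induction S using Finset.induction_on generalizing n with
  | empty => simp [ratSum, PowerSeries.coeff_one]
  | insert y S hy ih =>
    have hz : ∀ T : Finset ι, PowerSeries.coeff 0 (∏ i ∈ T, factor t (v i)) = 1 := by
      intro T
      rw [PowerSeries.coeff_zero_eq_constantCoeff_apply, map_prod]
      refine Finset.prod_eq_one fun i _ => ?_
      rw [← PowerSeries.coeff_zero_eq_constantCoeff_apply]
      simp [factor]
    induction n with
    | zero =>
      have h1 := factor_mul t (v y) (∏ i ∈ S, factor t (v i)) 0
      have h2 := ratSum_insert t v hv S y hy 0
      rw [← Finset.prod_insert (f := fun i => factor t (v i)) hy, hz, hz, ih] at h1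
      rw [ratSum_zero t v hv hv0, ratSum_zero t v hv hv0, Finset.card_insert_of_notMem hy] at h2
      linear_combination h1 - h2
    | succ n ihn =>
      have h1 := factor_mul t (v y) (∏ i ∈ S, factor t (v i)) (n + 1)
      have h2 := ratSum_insert t v hv S y hy (n + 1)
      rw [← Finset.prod_insert (f := fun i => factor t (v i)) hy, ih, ih, ihn] at h1
      linear_combination h1 - h2

end Existence

/-- For `n > 0` the limit exists; the coefficient of a monomial of degree `n` in `r` variables
is `(1 - t) ^ r`. -/
theorem isHallLittlewood_explicit (t : ℂ) (n : ℕ) (hn : 0 < n) :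
    IsHallLittlewood t n
      (fun d => if d.degree = n then (1 - t) ^ #d.support else 0) := by
  classical
  intro k
  refine ⟨∑ d ∈ finsuppAntidiag univ n, MvPolynomial.monomial d ((1 - t) ^ #d.support), ?_, ?_⟩
  · intro d
    have h1 : MvPowerSeries.coeff (d.mapDomain (firstVars k))
        (fun d => if d.degree = n then (1 - t) ^ #d.support else 0 : PSeries) =
        if (d.mapDomain (firstVars k)).degree = n then
          (1 - t) ^ #(d.mapDomain (firstVars k)).support else 0 := rfl
    rw [h1, Finsupp.degree_mapDomain, ← Finsupp.embDomain_eq_mapDomain, Finsupp.support_embDomain,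
      Finset.card_map, MvPolynomial.coeff_sum]
    simp only [MvPolynomial.coeff_monomial]
    rw [Finset.sum_ite_eq']
    congr 1
    simp [Finsupp.degree_eq_sum]
  · obtain ⟨m, rfl⟩ : ∃ m, n = m + 1 := ⟨n - 1, by omega⟩
    have h := coeff_prod_factor
      (algebraMap (MvPolynomial (Fin k) ℂ) (FractionRing (MvPolynomial (Fin k) ℂ))
        (MvPolynomial.C t))
      (fun i => algebraMap (MvPolynomial (Fin k) ℂ) (FractionRing (MvPolynomial (Fin k) ℂ))
        (MvPolynomial.X i))
      (fun a b hab => MvPolynomial.X_injective (IsFractionRing.injective _ _ hab))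
      (fun i hi => MvPolynomial.X_ne_zero (R := ℂ) i
        (IsFractionRing.injective _ _ (hi.trans (map_zero _).symm)))
      univ m
    have h' : hallLittlewoodRat t (m + 1) k = _ := h.symm
    rw [h', PowerSeries.coeff_prod, map_sum]
    refine Finset.sum_congr rfl fun d _ => ?_
    simp only [factor, PowerSeries.coeff_mk]
    rw [MvPolynomial.monomial_eq, Finsupp.prod_fintype _ _ (fun _ => pow_zero _), map_mul,
      map_prod, map_pow, map_sub, map_one, map_pow, map_sub, map_one]
    have h2 : (#d.support : ℕ) = ∑ i, if d i = 0 then 0 else 1 := by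
      have h3 : d.support = ({i | ¬ d i = 0} : Finset (Fin k)) := by ext i; simp
      rw [h3, Finset.card_filter]
      exact Finset.sum_congr rfl fun i _ => by by_cases hi : d i = 0 <;> simp [hi]
    rw [h2, ← Finset.prod_pow_eq_pow_sum, ← Finset.prod_mul_distrib]
    refine Finset.prod_congr rfl fun i _ => ?_
    by_cases hi : d i = 0 <;> simp [hi]

/-- The limit is unique. -/
theorem IsHallLittlewood.unique {t : ℂ} {n : ℕ} {F G : PSeries} (hF : IsHallLittlewood t n F)
    (hG : IsHallLittlewood t n G) : F = G := by
  ext d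
  obtain ⟨k, e, rfl⟩ : ∃ (k : ℕ) (e : Fin k →₀ ℕ), e.mapDomain (firstVars k) = d := by
    refine ⟨d.support.sup (fun x => (x : ℕ)), ?_⟩
    have : d ∈ Set.range (Finsupp.embDomain (firstVars (d.support.sup (fun x => (x : ℕ))))) := by
      rw [Finsupp.mem_range_embDomain_iff]
      intro x hx
      have hx' : (x : ℕ) ≤ d.support.sup (fun x => (x : ℕ)) :=
        Finset.le_sup (f := fun x : ℕ+ => (x : ℕ)) hx
      refine ⟨⟨x.natPred, ?_⟩, PNat.succPNat_natPred x⟩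
      have := PNat.natPred_add_one x
      omega
    obtain ⟨e, he⟩ := this
    exact ⟨e, by rw [← Finsupp.embDomain_eq_mapDomain, he]⟩
  obtain ⟨p, hp, hp'⟩ := hF k
  obtain ⟨r, hr, hr'⟩ := hG k
  rw [← hp, ← hr, IsFractionRing.injective _ _ (hp'.trans hr'.symm)]

/-- The symmetric function `q_n(X; t)`: `q_0 = 1`, and `q_n` is the limit of
`q_n(x₁, …, x_k; t)` for `k → ∞` if `n > 0`. -/
def hallLittlewoodQ (t : ℂ) (n : ℕ) : PSeries :=
  if hn : 0 < n then
    Exists.choose (p := IsHallLittlewood t n) ⟨_, isHallLittlewood_explicit t n hn⟩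
  else 1

theorem coeff_hallLittlewoodQ (t : ℂ) (n : ℕ) (d : ℕ+ →₀ ℕ) :
    MvPowerSeries.coeff d (hallLittlewoodQ t n) =
      if d.degree = n then (1 - t) ^ #d.support else 0 := by
  classical
  by_cases hn : 0 < n
  · rw [hallLittlewoodQ, dif_pos hn]
    have h := (Exists.choose_spec (p := IsHallLittlewood t n)
      ⟨_, isHallLittlewood_explicit t n hn⟩).unique (isHallLittlewood_explicit t n hn)
    rw [h]
    rfl
  · obtain rfl : n = 0 := by omega
    rw [hallLittlewoodQ, dif_neg hn, MvPowerSeries.coeff_one]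
    by_cases hd : d = 0
    · simp [hd]
    · simp [hd, Finsupp.degree_eq_zero_iff]

theorem hallLittlewoodQ_mem_sym (t : ℂ) (n : ℕ) : hallLittlewoodQ t n ∈ Sym := by
  refine ⟨⟨n, fun d hd => ?_⟩, fun s d => ?_⟩
  · by_contra h
    apply hd
    rw [coeff_hallLittlewoodQ, if_neg (by omega)]
  · rw [coeff_hallLittlewoodQ, coeff_hallLittlewoodQ, Finsupp.degree_mapDomain]
    have : (d.mapDomain s).support = d.support.map s.toEmbedding := by
      rw [← Finsupp.support_embDomain, Finsupp.embDomain_eq_mapDomain]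
      rfl
    rw [this, Finset.card_map]

/-- The subalgebra `Λ_t` of `Λ` generated by all `q_n(X; t)`. -/
def hallLittlewoodAlgebra (t : ℂ) : Subalgebra ℂ PSeries :=
  Algebra.adjoin ℂ (Set.range (hallLittlewoodQ t))

theorem hallLittlewoodAlgebra_le_sym (t : ℂ) : hallLittlewoodAlgebra t ≤ Sym := by
  refine Algebra.adjoin_le ?_
  rintro f ⟨n, rfl⟩
  exact hallLittlewoodQ_mem_sym t n

/-- The defining property of the `ℂ`-algebra homomorphism `θ_t : Λ → Λ_t`:
`θ_t(h_n) = q_n(X; t)` for all `n ≥ 0`. -/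
def IsTheta (t : ℂ) (θ : Sym →ₐ[ℂ] hallLittlewoodAlgebra t) : Prop :=
  ∀ n : ℕ, (θ ⟨hsymm n, hsymm_mem n⟩ : PSeries) = hallLittlewoodQ t n

end

end QSymTheta

namespace QSymTheta

noncomputable section

open Finset

/-! The condition on `f` in the definition of `L_π` says exactly that `π` lists the positions in
increasing order of the pairs `(f i, ±i)`, with the sign of `f i` (`key`). These pairs are distinct,
so every word `f` is counted by exactly one permutation. Cutting a word of length `n + m` into two
blocks therefore gives `L_π L_σ = ∑ L_τ`, the sum over the shifted shuffles `τ` of `π` and `σ`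
(`permFundamental_mul`). The weight of a word is the product of the weights of its blocks, so the
structure constants do not involve `q`. Read along the chain, the condition only compares neighbours
and sees only the descents of `π`, so `L_π` depends only on `Des(π)`.

For `q = 0` only words with positive letters survive, and the `L_{n,I}^{(0)}` form the usual
fundamental basis of `QSym` (`fundamentalCoord_fundamental`, `mem_span_fundamentals_zero`).
Replacing them by the `L_{n,I}^{(q)}` is thus a well-defined linear map `thetaLinear`, and it is
multiplicative because both families obey the same product formula.

Since `h_n = L_{n,∅}^{(0)}`, its image is `L_{n,∅}^{(q)}`. The words counted there are weakly
increasing with each negative letter used at most once, so each variable that occurs contributes a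
factor `1 + q`. The coefficients `(1 + q) ^ #d.support` are those of `q_n(X; -q)`
(`fundamental_empty`). As the `h_n` generate `Λ` (`hsymmAlgebra_eq_sym`), the restriction of `Θ_q`
to `Λ` lands in `Λ_{-q}` and is the only candidate for `θ_{-q}`. -/

theorem SignedPos.isPos_iff (z : SignedPos) : z.IsPos ↔ ¬ z.IsNeg := by
  simp [SignedPos.IsPos, SignedPos.IsNeg]

/-! ### Enriched partitions of a chain as sorted words -/

/-- The key by which the positions of a word are sorted: first by the letter, and among equal
letters from left to right if the letter is positive, from right to left if it is negative. -/
def key {n : ℕ} (f : Fin n → SignedPos) (i : Fin n) : SignedPos ×ₗ ℤ :=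
  toLex (f i, if (f i).IsNeg then -(i : ℤ) else i)

theorem key_lt_iff {n : ℕ} (f : Fin n → SignedPos) (i j : Fin n) :
    key f i < key f j ↔
      f i < f j ∨ (f i = f j ∧ if (f i).IsNeg then j < i else i < j) := by
  rw [key, key, Prod.Lex.toLex_lt_toLex]
  refine or_congr Iff.rfl (and_congr_right fun h => ?_)
  simp only at h ⊢
  rw [h]
  split_ifs <;> simp

theorem key_injective {n : ℕ} (f : Fin n → SignedPos) : Function.Injective (key f) := by
  intro i j h
  have h1 : (f i, if (f i).IsNeg then -(i : ℤ) else i) =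
    (f j, if (f j).IsNeg then -(j : ℤ) else j) := toLex.injective h
  rw [Prod.mk.injEq] at h1
  obtain ⟨h2, h3⟩ := h1
  rw [h2] at h3
  split_ifs at h3 <;> (ext; omega)

/-- The two tie rules, positive when labels increase and negative when they decrease, are the
comparison of the second components of the keys. So `f` is enriched exactly when `π` is its sorting
permutation. -/
theorem isEnriched_chainPoset_iff {n : ℕ} (π : Equiv.Perm (Fin n)) (f : Fin n → SignedPos) :
    IsEnriched (chainPoset π) f ↔ StrictMono (key f ∘ π) := by
  constructor
  · rintro ⟨h1, h2⟩ a b hab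
    have hlt : (chainPoset π).lt (π a) (π b) := by simpa [chainPoset] using hab
    rw [Function.comp, Function.comp, key_lt_iff]
    rcases lt_or_gt_of_ne (π.injective.ne hab.ne) with h | h
    · refine (h1 _ _ hlt h).imp_right fun ⟨h3, h4⟩ => ⟨h3, ?_⟩
      rw [SignedPos.isPos_iff] at h4
      rwa [if_neg h4]
    · refine (h2 _ _ hlt h).imp_right fun ⟨h3, h4⟩ => ⟨h3, ?_⟩
      rwa [if_pos h4]
  · intro h
    have key' : ∀ i j, (chainPoset π).lt i j →
        f i < f j ∨ (f i = f j ∧ if (f i).IsNeg then j < i else i < j) := by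
      intro i j hij
      have := h (show π.symm i < π.symm j from hij)
      simpa [key_lt_iff] using this
    refine ⟨fun i j hij hlt => ?_, fun i j hij hlt => ?_⟩
    · refine (key' i j hij).imp_right fun ⟨h3, h4⟩ => ⟨h3, ?_⟩
      rw [SignedPos.isPos_iff]
      intro hn
      rw [if_pos hn] at h4
      exact lt_asymm hlt h4
    · refine (key' i j hij).imp_right fun ⟨h3, h4⟩ => ⟨h3, ?_⟩
      by_contra hn
      rw [if_neg hn] at h4
      exact lt_asymm hlt h4

theorem strictMono_iff_lt_nextPos {n : ℕ} {α : Type*} [Preorder α] (g : Fin n → α) :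
    StrictMono g ↔ ∀ i : Fin (n - 1), g (pos i) < g (nextPos i) := by
  cases n with
  | zero => exact ⟨fun _ i => i.elim0, fun _ i => i.elim0⟩
  | succ n => exact Fin.strictMono_iff_lt_succ

theorem monotone_iff_le_nextPos {n : ℕ} {α : Type*} [Preorder α] (g : Fin n → α) :
    Monotone g ↔ ∀ i : Fin (n - 1), g (pos i) ≤ g (nextPos i) := by
  cases n with
  | zero => exact ⟨fun _ i => i.elim0, fun _ i => i.elim0⟩
  | succ n => exact Fin.monotone_iff_le_succ

/-- Enriched partitions of a chain, read along the chain. -/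
def IsEnrichedWord {n : ℕ} (I : Finset (Fin (n - 1))) (g : Fin n → SignedPos) : Prop :=
  ∀ i, g (pos i) < g (nextPos i) ∨
    (g (pos i) = g (nextPos i) ∧ ((g (pos i)).IsNeg ↔ i ∈ I))

/-- Strict monotonicity need only be tested on neighbours, and for neighbours a tie refers to `π`
only through the presence of a descent. This is why `L_π` depends only on the descent set. -/
theorem isEnriched_chainPoset_iff_word {n : ℕ} (π : Equiv.Perm (Fin n)) (f : Fin n → SignedPos) :
    IsEnriched (chainPoset π) f ↔ IsEnrichedWord (descents π) (f ∘ π) := by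
  rw [isEnriched_chainPoset_iff, strictMono_iff_lt_nextPos]
  refine forall_congr' fun i => ?_
  rw [Function.comp, Function.comp, key_lt_iff]
  refine or_congr Iff.rfl (and_congr_right fun _ => ?_)
  have hne : π (pos i) ≠ π (nextPos i) := by
    refine π.injective.ne (Fin.ne_of_lt ?_)
    exact Nat.lt_succ_self _
  simp only [descents, mem_filter, mem_univ, true_and, Function.comp]
  split_ifs with h
  · simp [h]
  · simp only [h, false_iff, not_lt]
    exact ⟨le_of_lt, fun h' => lt_of_le_of_ne h' hne⟩

/-- The exponent of the monomial of a word. -/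
def wordContent {n : ℕ} (g : Fin n → SignedPos) : ℕ+ →₀ ℕ := ∑ i, Finsupp.single (g i).abs 1

/-- The weight of a word. -/
def wordWeight (q : ℂ) {n : ℕ} (g : Fin n → SignedPos) : ℂ := ∏ i, if (g i).IsNeg then q else 1

theorem content_chainPoset {n : ℕ} (π : Equiv.Perm (Fin n)) (f : Fin n → SignedPos) :
    content (chainPoset π) f = wordContent f := rfl

theorem wordContent_comp {n : ℕ} (π : Equiv.Perm (Fin n)) (f : Fin n → SignedPos) :
    wordContent (f ∘ π) = wordContent f :=
  Equiv.sum_comp π fun i => Finsupp.single (f i).abs 1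

theorem wordWeight_comp (q : ℂ) {n : ℕ} (π : Equiv.Perm (Fin n)) (f : Fin n → SignedPos) :
    wordWeight q (f ∘ π) = wordWeight q f :=
  Equiv.prod_comp π fun i => if (f i).IsNeg then q else 1

theorem degree_wordContent {n : ℕ} (f : Fin n → SignedPos) : (wordContent f).degree = n := by
  simp [wordContent, map_sum]

theorem finite_wordContent {n : ℕ} (d : ℕ+ →₀ ℕ) :
    {f : Fin n → SignedPos | wordContent f = d}.Finite := by
  -- In an antichain every map is enriched, so the finiteness already known for enriched maps covers
  -- all words.
  let P : LabelledWeightedPoset n := ⟨fun _ _ => False, fun _ => id, fun _ _ _ h => h.elim, 1⟩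
  refine (finite_enriched P d).subset fun f hf => ⟨⟨fun _ _ h => h.elim, fun _ _ h => h.elim⟩, ?_⟩
  exact hf

-- This form, indexed by labels, serves for products; the form `coeff_permFundamental_word`, indexed
-- by positions along the chain, serves for computing coefficients.
open Classical in
theorem coeff_permFundamental (q : ℂ) {n : ℕ} (π : Equiv.Perm (Fin n)) (d : ℕ+ →₀ ℕ) :
    MvPowerSeries.coeff d (permFundamental q π) =
      ∑ f ∈ (finite_wordContent (n := n) d).toFinset with StrictMono (key f ∘ π),
        wordWeight q f := by
  rw [permFundamental, coeff_Gamma]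
  refine Finset.sum_congr ?_ fun _ _ => rfl
  ext f
  simp [isEnriched_chainPoset_iff, content_chainPoset, and_comm]

open Classical in
theorem coeff_permFundamental_word (q : ℂ) {n : ℕ} (π : Equiv.Perm (Fin n)) (d : ℕ+ →₀ ℕ) :
    MvPowerSeries.coeff d (permFundamental q π) =
      ∑ g ∈ (finite_wordContent (n := n) d).toFinset with IsEnrichedWord (descents π) g,
        wordWeight q g := by
  rw [permFundamental, coeff_Gamma]
  refine Finset.sum_bij' (fun f _ => f ∘ π) (fun g _ => g ∘ π.symm) ?_ ?_ ?_ ?_ ?_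
  · intro f hf
    rw [Set.Finite.mem_toFinset] at hf
    simpa [wordContent_comp, ← isEnriched_chainPoset_iff_word] using ⟨hf.2, hf.1⟩
  · intro g hg
    simp only [mem_filter, Set.Finite.mem_toFinset, Set.mem_ofPred_eq] at hg ⊢
    rw [isEnriched_chainPoset_iff_word, content_chainPoset, wordContent_comp]
    refine ⟨?_, hg.1⟩
    convert hg.2
    ext; simp
  · intro f _; ext; simp
  · intro f _; ext; simp
  · intro f _; exact (wordWeight_comp q π f).symm

theorem permFundamental_eq_of_descents_eq (q : ℂ) {n : ℕ} {π σ : Equiv.Perm (Fin n)}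
    (h : descents π = descents σ) : permFundamental q π = permFundamental q σ := by
  ext d
  rw [coeff_permFundamental_word, coeff_permFundamental_word, h]

theorem permFundamental_eq_fundamental (q : ℂ) {n : ℕ} (π : Equiv.Perm (Fin n)) :
    permFundamental q π = fundamental q n (descents π) :=
  permFundamental_eq_of_descents_eq q (exists_descents_eq n (descents π)).choose_spec.symm

open Classical in
theorem coeff_fundamental (q : ℂ) (n : ℕ) (I : Finset (Fin (n - 1))) (d : ℕ+ →₀ ℕ) :
    MvPowerSeries.coeff d (fundamental q n I) =
      ∑ g ∈ (finite_wordContent (n := n) d).toFinset with IsEnrichedWord I g,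
        wordWeight q g := by
  rw [fundamental, coeff_permFundamental_word, (exists_descents_eq n I).choose_spec]

theorem coeff_fundamental_of_degree_ne (q : ℂ) (n : ℕ) (I : Finset (Fin (n - 1)))
    (d : ℕ+ →₀ ℕ) (h : d.degree ≠ n) : MvPowerSeries.coeff d (fundamental q n I) = 0 := by
  classical
  rw [coeff_fundamental]
  refine Finset.sum_eq_zero fun g hg => ?_
  simp only [mem_filter, Set.Finite.mem_toFinset, Set.mem_ofPred_eq] at hg
  exact absurd (hg.1 ▸ degree_wordContent g) h

/-! Products -/

/-- `τ` is a shifted shuffle of `π` and `σ`. -/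
def IsShuffle {n m : ℕ} (π : Equiv.Perm (Fin n)) (σ : Equiv.Perm (Fin m))
    (τ : Equiv.Perm (Fin (n + m))) : Prop :=
  StrictMono (τ.symm ∘ Fin.castAdd m ∘ π) ∧ StrictMono (τ.symm ∘ Fin.natAdd n ∘ σ)

theorem existsUnique_strictMono_comp {n : ℕ} {α : Type*} [LinearOrder α] (k : Fin n → α)
    (hk : Function.Injective k) : ∃! τ : Equiv.Perm (Fin n), StrictMono (k ∘ τ) := by
  refine ⟨Tuple.sort k, (Tuple.monotone_sort k).strictMono_of_injective
    (hk.comp (Tuple.sort k).injective), fun τ hτ => ?_⟩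
  have := Tuple.unique_monotone hτ.monotone (Tuple.monotone_sort k)
  ext i : 1
  exact hk (congrFun this i)

/-- Within one block, concatenation shifts all positions equally and leaves the comparison of keys
unchanged. Hence the sorting permutation of the long word orders each block exactly as that block's
own keys do. -/
theorem strictMono_key_append_iff {n m : ℕ} (f : Fin n → SignedPos) (g : Fin m → SignedPos)
    (π : Equiv.Perm (Fin n)) (σ : Equiv.Perm (Fin m)) (τ : Equiv.Perm (Fin (n + m)))
    (hτ : StrictMono (key (Fin.append f g) ∘ τ)) :
    IsShuffle π σ τ ↔ StrictMono (key f ∘ π) ∧ StrictMono (key g ∘ σ) := by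
  have h0 : ∀ x y, τ.symm x < τ.symm y ↔ key (Fin.append f g) x < key (Fin.append f g) y := by
    intro x y
    rw [← hτ.lt_iff_lt]
    simp
  have h1 : ∀ a b, τ.symm (Fin.castAdd m a) < τ.symm (Fin.castAdd m b) ↔ key f a < key f b := by
    intro a b
    rw [h0, key_lt_iff, key_lt_iff]
    simp only [Fin.append_left, Fin.lt_def, Fin.val_castAdd]
  have h2 : ∀ a b, τ.symm (Fin.natAdd n a) < τ.symm (Fin.natAdd n b) ↔ key g a < key g b := by
    intro a b
    rw [h0, key_lt_iff, key_lt_iff]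
    simp
  simp only [IsShuffle, StrictMono, Function.comp, h1, h2]

theorem wordContent_append {n m : ℕ} (f : Fin n → SignedPos) (g : Fin m → SignedPos) :
    wordContent (Fin.append f g) = wordContent f + wordContent g := by
  simp [wordContent, Fin.sum_univ_add]

theorem wordWeight_append (q : ℂ) {n m : ℕ} (f : Fin n → SignedPos) (g : Fin m → SignedPos) :
    wordWeight q (Fin.append f g) = wordWeight q f * wordWeight q g := by
  simp [wordWeight, Fin.prod_univ_add]

open Classical in
/-- The product formula. -/
theorem permFundamental_mul (q : ℂ) {n m : ℕ} (π : Equiv.Perm (Fin n))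
    (σ : Equiv.Perm (Fin m)) :
    permFundamental q π * permFundamental q σ =
      ∑ τ with IsShuffle π σ τ, permFundamental q τ := by
  ext d
  rw [MvPowerSeries.coeff_mul, map_sum]
  simp only [coeff_permFundamental]
  -- Both sides are sums over the long words whose two blocks are sorted by `π` and by `σ`.
  let F : Finset (Fin (n + m) → SignedPos) :=
    {f ∈ (finite_wordContent (n := n + m) d).toFinset |
      StrictMono (key (fun i => f (Fin.castAdd m i)) ∘ π) ∧
      StrictMono (key (fun i => f (Fin.natAdd n i)) ∘ σ)}
  trans ∑ f ∈ F, wordWeight q f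
  · simp only [Finset.sum_mul_sum, ← Finset.sum_product']
    rw [Finset.sum_sigma']
    refine Finset.sum_bij' (fun x _ => Fin.append x.2.1 x.2.2)
      (fun f _ => ⟨(wordContent fun i => f (Fin.castAdd m i), wordContent fun i => f (Fin.natAdd n i)),
        (fun i => f (Fin.castAdd m i), fun i => f (Fin.natAdd n i))⟩) ?_ ?_ ?_ ?_ ?_
    · rintro ⟨⟨d1, d2⟩, f, g⟩ h
      simp only [mem_sigma, HasAntidiagonal.mem_antidiagonal, mem_product, mem_filter, Set.Finite.mem_toFinset,
        Set.mem_ofPred_eq] at h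
      simp only [F, mem_filter, Set.Finite.mem_toFinset, Set.mem_ofPred_eq, Fin.append_left,
        Fin.append_right, wordContent_append]
      exact ⟨by rw [h.2.1.1, h.2.2.1, h.1], h.2.1.2, h.2.2.2⟩
    · intro f h
      simp only [F, mem_filter, Set.Finite.mem_toFinset, Set.mem_ofPred_eq] at h
      simp only [mem_sigma, HasAntidiagonal.mem_antidiagonal, mem_product, mem_filter, Set.Finite.mem_toFinset,
        Set.mem_ofPred_eq, true_and]
      refine ⟨?_, h.2⟩
      rw [← wordContent_append, Fin.append_castAdd_natAdd, h.1]
    · rintro ⟨⟨d1, d2⟩, f, g⟩ h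
      simp only [mem_sigma, HasAntidiagonal.mem_antidiagonal, mem_product, mem_filter, Set.Finite.mem_toFinset,
        Set.mem_ofPred_eq] at h
      obtain ⟨-, ⟨rfl, -⟩, rfl, -⟩ := h
      simp
    · intro f h
      exact Fin.append_castAdd_natAdd
    · rintro ⟨⟨d1, d2⟩, f, g⟩ h
      exact (wordWeight_append q f g).symm
  · symm
    -- After exchanging the sums, the inner index set is a singleton: each long word has a unique
    -- sorting permutation, and it is a shuffle exactly when the word lies in `F`.
    rw [Finset.sum_comm' (t' := F)
      (s' := fun f => {(existsUnique_strictMono_comp (key f) (key_injective f)).choose})]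
    · simp
    · intro τ f
      obtain ⟨h1, h2⟩ := (existsUnique_strictMono_comp (key f) (key_injective f)).choose_spec
      have h3 := fun h => strictMono_key_append_iff (fun i => f (Fin.castAdd m i))
        (fun i => f (Fin.natAdd n i)) π σ τ h
      rw [Fin.append_castAdd_natAdd] at h3
      simp only [F, mem_filter, mem_univ, true_and, Set.Finite.mem_toFinset, Set.mem_ofPred_eq,
        mem_singleton]
      constructor
      · rintro ⟨ha, hb, hc⟩
        exact ⟨h2 _ hc, hb, (h3 hc).1 ha⟩
      · rintro ⟨rfl, hb, hc⟩
        exact ⟨(h3 h1).2 hc, hb, h1⟩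

theorem fundamental_zero_empty (q : ℂ) : fundamental q 0 ∅ = 1 := by
  classical
  ext d
  rw [coeff_fundamental, MvPowerSeries.coeff_one]
  by_cases hd : d = 0
  · rw [if_pos hd, Finset.sum_eq_single (fun i => i.elim0)]
    · simp [wordWeight]
    · intro b _ hb
      exact absurd (Subsingleton.elim _ _) hb
    · intro h
      exfalso; apply h
      simp only [mem_filter, Set.Finite.mem_toFinset, Set.mem_ofPred_eq]
      exact ⟨by simp [wordContent, hd], fun i => i.elim0⟩
  · rw [if_neg hd, ← coeff_fundamental]
    refine coeff_fundamental_of_degree_ne q 0 ∅ d ?_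
    rwa [Ne, Finsupp.degree_eq_zero_iff]

theorem permFundamental_mem_span (q : ℂ) {n : ℕ} (π : Equiv.Perm (Fin n)) :
    permFundamental q π ∈ Submodule.span ℂ (fundamentals q) :=
  Submodule.subset_span ⟨n, _, permFundamental_eq_fundamental q π⟩

/-- By the product formula the span is already closed under multiplication, and it contains `1 =
L_{0,∅}`. -/
theorem toSubmodule_fundamentalAlgebra (q : ℂ) :
    Subalgebra.toSubmodule (fundamentalAlgebra q) = Submodule.span ℂ (fundamentals q) := by
  classical
  refine le_antisymm ?_ (Algebra.span_le_adjoin ℂ _)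
  have hmul : ∀ x y, x ∈ Submodule.span ℂ (fundamentals q) →
      y ∈ Submodule.span ℂ (fundamentals q) → x * y ∈ Submodule.span ℂ (fundamentals q) := by
    intro x y hx hy
    induction hx using Submodule.span_induction with
    | mem x hx =>
      induction hy using Submodule.span_induction with
      | mem y hy =>
        obtain ⟨n, I, rfl⟩ := hx
        obtain ⟨m, J, rfl⟩ := hy
        rw [fundamental, fundamental, permFundamental_mul]
        exact Submodule.sum_mem _ fun τ _ => permFundamental_mem_span q τ
      | zero => rw [mul_zero]; exact Submodule.zero_mem _
      | add y z _ _ h1 h2 => rw [mul_add]; exact Submodule.add_mem _ h1 h2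
      | smul c y _ h => rw [mul_smul_comm]; exact Submodule.smul_mem _ c h
    | zero => rw [zero_mul]; exact Submodule.zero_mem _
    | add y z _ _ h1 h2 => rw [add_mul]; exact Submodule.add_mem _ h1 h2
    | smul c y _ h => rw [smul_mul_assoc]; exact Submodule.smul_mem _ c h
  have h1 : (1 : PSeries) ∈ Submodule.span ℂ (fundamentals q) :=
    Submodule.subset_span ⟨0, ∅, (fundamental_zero_empty q).symm⟩
  exact Algebra.adjoin_le (S := (Submodule.span ℂ (fundamentals q)).toSubalgebra h1 hmul)
    Submodule.subset_span

/-! ### Weakly increasing words, multisets, and coefficients for `q = 0` -/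

theorem exists_monotone_map_eq {n : ℕ} {α : Type*} [LinearOrder α] (s : Multiset α)
    (hs : s.card = n) : ∃ w : Fin n → α, Monotone w ∧ univ.val.map w = s := by
  obtain ⟨l, rfl⟩ := Quotient.exists_rep s
  obtain rfl : l.length = n := hs
  let w : Fin l.length → α := l.get
  refine ⟨w ∘ Tuple.sort w, Tuple.monotone_sort w, ?_⟩
  rw [Fin.univ_val_map]
  refine Multiset.coe_eq_coe.2 (((Tuple.sort w).ofFn_comp_perm w).trans ?_)
  rw [List.ofFn_get]

theorem monotone_eq_of_map_eq {n : ℕ} {α : Type*} [LinearOrder α] {v w : Fin n → α}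
    (hv : Monotone v) (hw : Monotone w) (h : univ.val.map v = univ.val.map w) : v = w := by
  rw [Fin.univ_val_map, Fin.univ_val_map, Multiset.coe_eq_coe] at h
  exact List.ofFn_injective (h.eq_of_pairwise' hv.sortedLE_ofFn.pairwise
    hw.sortedLE_ofFn.pairwise)

theorem sum_single_eq_toFinsupp {n : ℕ} {α : Type*} [DecidableEq α] (w : Fin n → α) :
    ∑ i, Finsupp.single (w i) 1 = Multiset.toFinsupp (univ.val.map w) := by
  rw [← Finset.sum_multiset_singleton (univ : Finset (Fin n)), ← Multiset.coe_mapAddMonoidHom,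
    map_sum, map_sum]
  simp

theorem map_eq_toMultiset {n : ℕ} (w : Fin n → ℕ+) {d : ℕ+ →₀ ℕ}
    (h : ∑ i, Finsupp.single (w i) 1 = d) : univ.val.map w = Finsupp.toMultiset d := by
  rw [← h, sum_single_eq_toFinsupp, Multiset.toFinsupp_toMultiset]

theorem exists_monotone_content {n : ℕ} (d : ℕ+ →₀ ℕ) (hd : d.degree = n) :
    ∃ w : Fin n → ℕ+, Monotone w ∧ ∑ i, Finsupp.single (w i) 1 = d := by
  obtain ⟨w, hw, h⟩ := exists_monotone_map_eq (n := n) (Finsupp.toMultiset d) (by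
    rw [Finsupp.card_toMultiset, ← hd]; rfl)
  exact ⟨w, hw, by rw [sum_single_eq_toFinsupp, h, Finsupp.toMultiset_toFinsupp]⟩

theorem IsEnrichedWord.monotone {n : ℕ} {I : Finset (Fin (n - 1))} {g : Fin n → SignedPos}
    (h : IsEnrichedWord I g) : Monotone g := by
  rw [monotone_iff_le_nextPos]
  exact fun i => (h i).elim le_of_lt fun h => h.1.le

theorem SignedPos.monotone_abs : Monotone SignedPos.abs :=
  fun _ _ h => (Prod.Lex.le_iff.mp h).elim le_of_lt fun h => h.1.le

/-- The coefficients of the fundamental quasisymmetric functions. -/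
theorem coeff_fundamental_zero {n : ℕ} (I : Finset (Fin (n - 1))) {w : Fin n → ℕ+}
    (hw : Monotone w) :
    MvPowerSeries.coeff (∑ i, Finsupp.single (w i) 1) (fundamental 0 n I) =
      if ∀ i ∈ I, w (pos i) < w (nextPos i) then 1 else 0 := by
  classical
  set d := ∑ i, Finsupp.single (w i) 1 with hd
  let g : Fin n → SignedPos := fun i => toLex (w i, true)
  rw [coeff_fundamental]
  -- At `q = 0` a negative letter makes the weight vanish, and the content determines a weakly
  -- increasing positive word. So at most the word `g` contributes.
  have key : ∀ f : Fin n → SignedPos, wordContent f = d → IsEnrichedWord I f →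
      wordWeight 0 f ≠ 0 → f = g := by
    intro f hf hI hf0
    have h1 : SignedPos.abs ∘ f = w := by
      refine monotone_eq_of_map_eq (SignedPos.monotone_abs.comp hI.monotone) hw ?_
      exact (map_eq_toMultiset _ hf).trans (map_eq_toMultiset w rfl).symm
    have h2 : ∀ i, (f i).IsPos := by
      intro i
      rw [SignedPos.isPos_iff]
      intro hn
      refine hf0 (Finset.prod_eq_zero (mem_univ i) (if_pos hn))
    funext i
    exact congrArg toLex (Prod.ext (congrFun h1 i) (h2 i))
  have hgI : IsEnrichedWord I g ↔ ∀ i ∈ I, w (pos i) < w (nextPos i) := by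
    have hneg : ∀ i, ¬ (g i).IsNeg := fun i => by simp [g, SignedPos.IsNeg]
    have hlt : ∀ i j, g i < g j ↔ w i < w j := by
      intro i j
      simp [g, Prod.Lex.toLex_lt_toLex]
    have heq : ∀ i j, g i = g j ↔ w i = w j := by
      intro i j
      simp [g]
    refine forall_congr' fun i => ?_
    rw [hlt, heq]
    have hle : w (pos i) ≤ w (nextPos i) := (monotone_iff_le_nextPos w).1 hw i
    simp only [hneg, false_iff]
    constructor
    · rintro (h | h) hi
      · exact h
      · exact absurd hi h.2
    · intro h
      rcases hle.lt_or_eq with h' | h'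
      · exact Or.inl h'
      · exact Or.inr ⟨h', fun hi => (h hi).ne h'⟩
  have hgd : wordContent g = d := rfl
  split_ifs with h
  · rw [Finset.sum_eq_single g]
    · simp [wordWeight, g, SignedPos.IsNeg]
    · intro f hf hfg
      simp only [mem_filter, Set.Finite.mem_toFinset, Set.mem_ofPred_eq] at hf
      by_contra h0
      exact hfg (key f hf.1 hf.2 h0)
    · intro hg
      exfalso; apply hg
      simp only [mem_filter, Set.Finite.mem_toFinset, Set.mem_ofPred_eq]
      exact ⟨hgd, hgI.2 h⟩
  · refine Finset.sum_eq_zero fun f hf => ?_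
    simp only [mem_filter, Set.Finite.mem_toFinset, Set.mem_ofPred_eq] at hf
    by_contra h0
    exact h (hgI.1 (key f hf.1 hf.2 h0 ▸ hf.2))

/-! ### The functions `L_{n,∅}^{(q)}` and the Hall–Littlewood functions -/

theorem isEnrichedWord_empty_iff {n : ℕ} (g : Fin n → SignedPos) :
    IsEnrichedWord ∅ g ↔ Monotone g ∧ ∀ i j, g i = g j → (g i).IsNeg → i = j := by
  constructor
  · intro h
    refine ⟨h.monotone, ?_⟩
    -- The identity realises the empty descent set, so the keys increase along all pairs of
    -- positions. This excludes ties between distant negative letters as well as neighbouring ones.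
    have h1 : descents (1 : Equiv.Perm (Fin n)) = ∅ := by
      ext i
      simp [descents, pos, nextPos]
    have h2 := isEnriched_chainPoset_iff_word (1 : Equiv.Perm (Fin n)) g
    rw [h1, isEnriched_chainPoset_iff] at h2
    have h3 : ∀ i j, i < j → key g i < key g j := h2.2 h
    intro i j hij hn
    by_contra hne
    rcases lt_or_gt_of_ne hne with h' | h'
    · have := h3 i j h'
      rw [key_lt_iff, if_pos hn, hij] at this
      rcases this with h4 | h4
      · exact lt_irrefl _ h4
      · exact lt_asymm h' h4.2
    · have := h3 j i h'
      rw [key_lt_iff, ← hij, if_pos hn] at this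
      rcases this with h4 | h4
      · exact lt_irrefl _ h4
      · exact lt_asymm h' h4.2
  · rintro ⟨h1, h2⟩ i
    rcases ((monotone_iff_le_nextPos g).1 h1 i).lt_or_eq with h | h
    · exact Or.inl h
    · refine Or.inr ⟨h, ?_⟩
      simp only [notMem_empty, iff_false]
      intro hn
      have := congrArg Fin.val (h2 _ _ h hn)
      simp [pos, nextPos] at this

/-- The absolute values of the negative letters of a word. -/
def negSet {n : ℕ} (g : Fin n → SignedPos) : Finset ℕ+ :=
  ({i | (g i).IsNeg} : Finset (Fin n)).image fun i => (g i).abs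

theorem mem_negSet {n : ℕ} (g : Fin n → SignedPos) (k : ℕ+) :
    k ∈ negSet g ↔ ∃ i, g i = toLex (k, false) := by
  simp only [negSet, mem_image, mem_filter, mem_univ, true_and]
  refine exists_congr fun i => ?_
  constructor
  · rintro ⟨h1, h2⟩
    exact congrArg toLex (Prod.ext h2 h1)
  · intro h
    rw [h]
    exact ⟨rfl, rfl⟩

theorem count_neg {n : ℕ} {g : Fin n → SignedPos}
    (hg : ∀ i j, g i = g j → (g i).IsNeg → i = j) (k : ℕ+) :
    (univ.val.map g).count (toLex (k, false)) = if k ∈ negSet g then 1 else 0 := by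
  split_ifs with h
  · obtain ⟨i, hi⟩ := (mem_negSet g k).1 h
    rw [← hi]
    rw [Multiset.count_map]
    have h1 : ({a | g i = g a} : Finset (Fin n)) = {i} := by
      ext a
      rw [mem_filter, mem_singleton]
      refine ⟨fun h => (hg i a h.2 ?_).symm, fun h => ⟨mem_univ _, h ▸ rfl⟩⟩
      rw [hi]
      rfl
    exact congrArg Finset.card h1
  · rw [Multiset.count_eq_zero]
    intro h'
    obtain ⟨i, -, hi⟩ := Multiset.mem_map.1 h'
    exact h ((mem_negSet g k).2 ⟨i, hi⟩)

theorem count_add_count {n : ℕ} (g : Fin n → SignedPos) (k : ℕ+) :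
    (univ.val.map g).count (toLex (k, false)) + (univ.val.map g).count (toLex (k, true)) =
      wordContent g k := by
  have h : wordContent g = Multiset.toFinsupp (univ.val.map fun i => (g i).abs) :=
    sum_single_eq_toFinsupp fun i => (g i).abs
  rw [h, Multiset.toFinsupp_apply]
  induction (univ : Finset (Fin n)).val using Multiset.induction_on with
  | empty => simp
  | cons a s ih =>
    rw [Multiset.map_cons, Multiset.map_cons, Multiset.count_cons, Multiset.count_cons,
      Multiset.count_cons, ← ih]
    have : (if k = (g a).abs then 1 else 0) = (if toLex (k, false) = g a then 1 else 0) +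
        (if toLex (k, true) = g a then 1 else 0) := by
      obtain ⟨⟨x, b⟩, hx⟩ : ∃ y, g a = toLex y := ⟨ofLex (g a), rfl⟩
      rw [hx]
      cases b <;> simp [SignedPos.abs] <;> rfl
    rw [this]
    omega

/-- A word of content `d` is determined by the set of `k` for which `-k` occurs: that letter occurs
once, the other letters of absolute value `k` are positive, and the order is forced. The set may be
any subset `S` of the support, with weight `q ^ #S`; the binomial theorem sums these weights. -/
theorem coeff_fundamental_empty (q : ℂ) (d : ℕ+ →₀ ℕ) :
    MvPowerSeries.coeff d (fundamental q d.degree ∅) = (1 + q) ^ #d.support := by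
  classical
  rw [coeff_fundamental, add_comm, ← Finset.sum_pow_mul_eq_add_pow]
  simp only [one_pow, mul_one]
  have hmem : ∀ g : Fin d.degree → SignedPos, g ∈ ({g ∈ (finite_wordContent d).toFinset |
      IsEnrichedWord ∅ g} : Finset _) ↔ wordContent g = d ∧ Monotone g ∧
        ∀ i j, g i = g j → (g i).IsNeg → i = j := by
    intro g
    rw [mem_filter, Set.Finite.mem_toFinset, Set.mem_ofPred_eq, isEnrichedWord_empty_iff]
  refine Finset.sum_bij (fun g _ => negSet g) ?_ ?_ ?_ ?_
  · intro g hg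
    obtain ⟨h1, h2, h3⟩ := (hmem g).1 hg
    rw [mem_powerset]
    intro k hk
    have := count_add_count g k
    rw [count_neg h3, if_pos hk, h1] at this
    rw [Finsupp.mem_support_iff]
    omega
  · intro g hg f hf hgf
    obtain ⟨h1, h2, h3⟩ := (hmem g).1 hg
    obtain ⟨h1', h2', h3'⟩ := (hmem f).1 hf
    refine monotone_eq_of_map_eq h2 h2' ?_
    ext z
    obtain ⟨⟨k, b⟩, rfl⟩ : ∃ y, z = toLex y := ⟨ofLex z, rfl⟩
    have hneg : (univ.val.map g).count (toLex (k, false)) =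
        (univ.val.map f).count (toLex (k, false)) := by
      rw [count_neg h3, count_neg h3', hgf]
    cases b
    · exact hneg
    · have e1 := count_add_count g k
      have e2 := count_add_count f k
      rw [h1] at e1
      rw [h1'] at e2
      omega
  · intro S hS
    rw [mem_powerset] at hS
    have hle : S.val ≤ Finsupp.toMultiset d := by
      rw [Multiset.le_iff_subset S.nodup]
      intro k hk
      rw [Finsupp.mem_toMultiset]
      exact hS hk
    -- For each `k ∈ S` one of the `d k` copies of `k` is made negative; sorting this multiset gives
    -- the required word.
    let s : Multiset SignedPos := S.val.map (fun k => toLex (k, false)) +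
      (Finsupp.toMultiset d - S.val).map (fun k => toLex (k, true))
    have habs : s.map SignedPos.abs = Finsupp.toMultiset d := by
      have h1 : ∀ b, SignedPos.abs ∘ (fun k => (toLex (k, b) : SignedPos)) = id := fun b => rfl
      simp only [s, Multiset.map_add, Multiset.map_map, h1, Multiset.map_id]
      exact add_tsub_cancel_of_le hle
    have hneg : ∀ k, s.count (toLex (k, false)) = if k ∈ S then 1 else 0 := by
      intro k
      have e1 : (S.val.map (fun k => (toLex (k, false) : SignedPos))).count (toLex (k, false)) =
          S.val.count k :=
        Multiset.count_map_eq_count' (fun k => (toLex (k, false) : SignedPos)) _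
          (fun a b h => by simpa using h) k
      have e2 : ((Finsupp.toMultiset d - S.val).map
          (fun k => (toLex (k, true) : SignedPos))).count (toLex (k, false)) = 0 := by
        rw [Multiset.count_eq_zero]
        intro h
        obtain ⟨x, -, hx⟩ := Multiset.mem_map.1 h
        simp at hx
      simp only [s]
      rw [Multiset.count_add, e1, e2, add_zero, Multiset.count_eq_of_nodup S.nodup]
      rfl
    obtain ⟨g, hg, hgs⟩ := exists_monotone_map_eq (n := d.degree) s (by
      rw [← Multiset.card_map SignedPos.abs, habs, Finsupp.card_toMultiset]; rfl)
    refine ⟨g, (hmem g).2 ⟨?_, hg, ?_⟩, ?_⟩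
    · have h : wordContent g = Multiset.toFinsupp (univ.val.map fun i => (g i).abs) :=
        sum_single_eq_toFinsupp fun i => (g i).abs
      rw [h]
      refine Eq.trans ?_ (Finsupp.toMultiset_toFinsupp d)
      rw [← habs, ← hgs, Multiset.map_map]
      rfl
    · intro i j hij hn
      by_contra hne
      have h1 : g i = toLex ((g i).abs, false) := congrArg toLex (Prod.ext rfl hn)
      have h2 := hneg (g i).abs
      rw [← h1, ← hgs] at h2
      have h3 : 2 ≤ (univ.val.map g).count (g i) := by
        rw [Multiset.count_map]
        have : ({i, j} : Finset (Fin d.degree)).card ≤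
            ({a | g i = g a} : Finset (Fin d.degree)).card := by
          refine Finset.card_le_card fun a ha => ?_
          rw [mem_insert, mem_singleton] at ha
          rw [mem_filter]
          rcases ha with rfl | rfl
          · exact ⟨mem_univ _, rfl⟩
          · exact ⟨mem_univ _, hij⟩
        rwa [Finset.card_pair hne] at this
      split_ifs at h2 <;> omega
    · ext k
      rw [mem_negSet]
      have h2 := hneg k
      rw [← hgs] at h2
      constructor
      · rintro ⟨i, hi⟩
        by_contra hk
        rw [if_neg hk, Multiset.count_eq_zero] at h2
        exact h2 (Multiset.mem_map.2 ⟨i, mem_univ_val i, hi⟩)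
      · intro hk
        rw [if_pos hk] at h2
        have : toLex (k, false) ∈ univ.val.map g := by
          rw [← Multiset.count_pos]; omega
        obtain ⟨i, -, hi⟩ := Multiset.mem_map.1 this
        exact ⟨i, hi⟩
  · intro g hg
    obtain ⟨h1, h2, h3⟩ := (hmem g).1 hg
    -- The exponent of `q` is the number of negative positions, which equals `#(negSet g)` because
    -- the negative letters are distinct.
    rw [wordWeight, Finset.prod_ite, Finset.prod_const, Finset.prod_const_one, mul_one, negSet,
      Finset.card_image_of_injOn]
    intro i hi j hj hij
    simp only [coe_filter, mem_univ, true_and, Set.mem_ofPred_eq] at hi hj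
    exact h3 i j (congrArg toLex (Prod.ext hij (hi.trans hj.symm))) hi

theorem fundamental_empty (q : ℂ) (n : ℕ) : fundamental q n ∅ = hallLittlewoodQ (-q) n := by
  ext d
  rw [coeff_hallLittlewoodQ]
  split_ifs with h
  · subst h
    rw [coeff_fundamental_empty, sub_neg_eq_add]
  · exact coeff_fundamental_of_degree_ne q n ∅ d h

theorem fundamental_zero_eq_hsymm (n : ℕ) : fundamental 0 n ∅ = hsymm n := by
  ext d
  rw [fundamental_empty, coeff_hallLittlewoodQ, coeff_hsymm]
  simp

/-! Quasisymmetric functions and sorted words -/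

/-- Both monomials have the same exponents in increasing order of their variables, so both
coefficients equal that of the same monomial in the initial variables. -/
theorem IsQuasisymmetric.coeff_mapDomain {f : PSeries} (hf : IsQuasisymmetric f)
    (d : ℕ+ →₀ ℕ) (φ : ℕ+ → ℕ+) (hφ : StrictMonoOn φ d.support) :
    MvPowerSeries.coeff (d.mapDomain φ) f = MvPowerSeries.coeff d f := by
  let e := d.support.orderEmbOfFin rfl
  have he : ∀ j, e j ∈ d.support := d.support.orderEmbOfFin_mem rfl
  have h1 : d = ∑ j, Finsupp.single (e j) (d (e j)) := by
    conv_lhs => rw [← Finsupp.sum_single d, Finsupp.sum]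
    conv_lhs => rw [← d.support.map_orderEmbOfFin_univ rfl]
    exact Finset.sum_map univ e.toEmbedding (fun x => Finsupp.single x (d x))
  have h2 : d.mapDomain φ = ∑ j, Finsupp.single (φ (e j)) (d (e j)) := by
    conv_lhs => rw [h1]
    simp only [Finsupp.mapDomain_finsetSum, Finsupp.mapDomain_single]
  rw [h2, hf _ (fun j => d (e j)) (fun j => φ (e j))
    fun a b hab => hφ (he a) (he b) (e.strictMono hab)]
  conv_rhs => rw [h1]
  exact (hf _ (fun j => d (e j)) e e.strictMono).symm

theorem eq_of_eq_of_monotone {n : ℕ} {v w : Fin n → ℕ+} (hv : Monotone v) (hw : Monotone w)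
    (h : ∀ i, v (pos i) < v (nextPos i) ↔ w (pos i) < w (nextPos i)) {a b : Fin n}
    (hab : v a = v b) : w a = w b := by
  wlog hle : a ≤ b
  · exact (this hv hw h hab.symm (le_of_not_ge hle)).symm
  -- Wherever `v` is stationary so is `w`, hence pairing `v` with the reversed `w` is still weakly
  -- increasing. On a stretch where `v` is constant, `w` is then both increasing and decreasing.
  let u : Fin n → ℕ+ ×ₗ ℕ+ᵒᵈ := fun c => toLex (v c, OrderDual.toDual (w c))
  have hu : Monotone u := by
    rw [monotone_iff_le_nextPos] at hv hw ⊢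
    intro i
    rw [Prod.Lex.toLex_le_toLex]
    rcases (hv i).lt_or_eq with h1 | h1
    · exact Or.inl h1
    · refine Or.inr ⟨h1, ?_⟩
      have h2 : ¬ w (pos i) < w (nextPos i) := fun h3 => ((h i).2 h3).ne h1
      exact not_lt.1 h2
  have h3 := hu hle
  rw [Prod.Lex.toLex_le_toLex] at h3
  exact le_antisymm (hw hle) (h3.resolve_left fun h4 => h4.ne hab).2

/-- Two weakly increasing words with the same rises differ by a renaming of letters that is strictly
increasing on the letters used. A quasisymmetric function thus has one free coefficient for each set
of rises. -/
theorem IsQuasisymmetric.coeff_eq_of_monotone {f : PSeries} (hf : IsQuasisymmetric f) {n : ℕ}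
    {v w : Fin n → ℕ+} (hv : Monotone v) (hw : Monotone w)
    (h : ∀ i, v (pos i) < v (nextPos i) ↔ w (pos i) < w (nextPos i)) :
    MvPowerSeries.coeff (∑ i, Finsupp.single (v i) 1) f =
      MvPowerSeries.coeff (∑ i, Finsupp.single (w i) 1) f := by
  classical
  let φ : ℕ+ → ℕ+ := fun x => if h : ∃ a, v a = x then w h.choose else 1
  have hφ : ∀ a, φ (v a) = w a := by
    intro a
    have ha : ∃ b, v b = v a := ⟨a, rfl⟩
    simp only [φ, dif_pos ha]
    exact eq_of_eq_of_monotone hv hw h ha.choose_spec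
  have h1 : ∑ i, Finsupp.single (w i) 1 = (∑ i, Finsupp.single (v i) 1).mapDomain φ := by
    simp only [Finsupp.mapDomain_finsetSum, Finsupp.mapDomain_single, hφ]
  rw [h1, hf.coeff_mapDomain]
  have hsupp : ∀ x ∈ (∑ i, Finsupp.single (v i) 1).support, ∃ a, v a = x := by
    intro x hx
    obtain ⟨a, -, ha⟩ := Finset.mem_biUnion.1 (Finsupp.support_finsetSum hx)
    exact ⟨a, (Finset.mem_singleton.mp (Finsupp.support_single_subset ha)).symm⟩
  intro x hx y hy hxy
  obtain ⟨a, rfl⟩ := hsupp x hx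
  obtain ⟨b, rfl⟩ := hsupp y hy
  rw [hφ, hφ]
  have hab : a ≤ b := by
    by_contra hba
    exact absurd (hv (le_of_not_ge hba)) (not_le.2 hxy)
  refine lt_of_le_of_ne (hw hab) fun h2 => hxy.ne ?_
  exact eq_of_eq_of_monotone hw hv (fun i => (h i).symm) h2

/-- A weakly increasing word that increases strictly exactly at the positions in `J`. -/
def stdWord (n : ℕ) (J : Finset (Fin (n - 1))) (a : Fin n) : ℕ+ :=
  Nat.succPNat #{j ∈ J | pos j < a}

theorem monotone_stdWord (n : ℕ) (J : Finset (Fin (n - 1))) : Monotone (stdWord n J) := by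
  intro a b hab
  refine Nat.succPNat_le_succPNat.2 (Finset.card_le_card fun j hj => ?_)
  rw [mem_filter] at hj ⊢
  exact ⟨hj.1, hj.2.trans_le hab⟩

theorem stdWord_lt_iff (n : ℕ) (J : Finset (Fin (n - 1))) (i : Fin (n - 1)) :
    stdWord n J (pos i) < stdWord n J (nextPos i) ↔ i ∈ J := by
  rw [stdWord, stdWord, Nat.succPNat_lt_succPNat]
  have hsub : ∀ j : Fin (n - 1), pos j < (nextPos i : Fin n) ↔ pos j < (pos i : Fin n) ∨ j = i := by
    intro j
    rw [Fin.lt_def, Fin.lt_def, Fin.ext_iff]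
    simp only [pos, nextPos]
    omega
  constructor
  · intro h
    by_contra hi
    refine absurd h (not_lt.2 (Finset.card_le_card fun j hj => ?_))
    rw [mem_filter] at hj ⊢
    refine ⟨hj.1, ((hsub j).1 hj.2).resolve_right ?_⟩
    rintro rfl
    exact hi hj.1
  · intro hi
    refine Finset.card_lt_card (Finset.ssubset_iff_of_subset (fun j hj => ?_) |>.2 ⟨i, ?_, ?_⟩)
    · rw [mem_filter] at hj ⊢
      exact ⟨hj.1, (hsub j).2 (Or.inl hj.2)⟩
    · rw [mem_filter]
      exact ⟨hi, (hsub i).2 (Or.inr rfl)⟩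
    · rw [mem_filter]
      exact fun h => lt_irrefl _ h.2

/-- The exponent of the monomial of `stdWord n J`. -/
def stdExponent (n : ℕ) (J : Finset (Fin (n - 1))) : ℕ+ →₀ ℕ :=
  ∑ i, Finsupp.single (stdWord n J i) 1

theorem degree_stdExponent (n : ℕ) (J : Finset (Fin (n - 1))) : (stdExponent n J).degree = n := by
  simp [stdExponent, map_sum]

/-- The matrix from the fundamental functions to these coefficients is the inclusion matrix of
subsets, which is invertible. -/
theorem coeff_stdExponent_fundamental_zero (n : ℕ) (I J : Finset (Fin (n - 1))) :
    MvPowerSeries.coeff (stdExponent n J) (fundamental 0 n I) = if I ⊆ J then 1 else 0 := by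
  rw [stdExponent, coeff_fundamental_zero I (monotone_stdWord n J)]
  simp only [stdWord_lt_iff, Finset.subset_iff]

/-! ### Fundamental coordinates by inversion over subsets -/

/-- Summation over subsets. -/
def subsetSum (κ : Type*) [DecidableEq κ] : (Finset κ → ℂ) →ₗ[ℂ] (Finset κ → ℂ) where
  toFun c J := ∑ I ∈ J.powerset, c I
  map_add' c c' := by ext J; simp [Finset.sum_add_distrib]
  map_smul' a c := by ext J; simp [Finset.mul_sum]

theorem subsetSum_injective (κ : Type*) [DecidableEq κ] :
    Function.Injective (subsetSum κ) := by
  rw [injective_iff_map_eq_zero]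
  intro c hc
  funext J
  induction J using Finset.strongInduction with
  | H J ih =>
    have h := congrFun hc J
    change ∑ I ∈ J.powerset, c I = 0 at h
    rw [Finset.sum_eq_single J] at h
    · exact h
    · intro I hI hne
      exact ih I ((Finset.mem_powerset.1 hI).ssubset_of_ne hne)
    · intro hJ
      exact absurd (Finset.mem_powerset_self J) hJ

/-- Summation over subsets, as a linear automorphism. -/
def subsetSumEquiv (κ : Type*) [Fintype κ] [DecidableEq κ] :
    (Finset κ → ℂ) ≃ₗ[ℂ] (Finset κ → ℂ) :=
  LinearEquiv.ofInjectiveEndo (subsetSum κ) (subsetSum_injective κ)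

theorem subsetSumEquiv_apply {κ : Type*} [Fintype κ] [DecidableEq κ] (c : Finset κ → ℂ)
    (J : Finset κ) : subsetSumEquiv κ c J = ∑ I ∈ J.powerset, c I := rfl

/-- The coordinates of the part of degree `n` of a quasisymmetric function with respect to the
fundamental basis. -/
def fundamentalCoord (n : ℕ) : PSeries →ₗ[ℂ] (Finset (Fin (n - 1)) → ℂ) :=
  (subsetSumEquiv (Fin (n - 1))).symm.toLinearMap ∘ₗ
    LinearMap.pi fun J => MvPowerSeries.coeff (stdExponent n J)

theorem sum_fundamentalCoord (n : ℕ) (f : PSeries) (J : Finset (Fin (n - 1))) :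
    ∑ I ∈ J.powerset, fundamentalCoord n f I = MvPowerSeries.coeff (stdExponent n J) f := by
  rw [← subsetSumEquiv_apply]
  simp [fundamentalCoord]

theorem fundamentalCoord_eq_zero (n : ℕ) (f : PSeries)
    (h : ∀ d : ℕ+ →₀ ℕ, d.degree = n → MvPowerSeries.coeff d f = 0) :
    fundamentalCoord n f = 0 := by
  refine (subsetSumEquiv (Fin (n - 1))).injective ?_
  ext J
  rw [subsetSumEquiv_apply, sum_fundamentalCoord, h _ (degree_stdExponent n J)]
  simp

theorem fundamentalCoord_fundamental (n : ℕ) (I : Finset (Fin (n - 1))) :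
    fundamentalCoord n (fundamental 0 n I) = Pi.single I 1 := by
  refine (subsetSumEquiv (Fin (n - 1))).injective ?_
  ext J
  rw [subsetSumEquiv_apply, sum_fundamentalCoord, subsetSumEquiv_apply,
    coeff_stdExponent_fundamental_zero]
  simp [Pi.single_apply]

/-! ### The homomorphism `Θ_q` -/

/-- The linear map that replaces every `L_{n,I}^{(0)}` by `L_{n,I}^{(q)}`. -/
def thetaLinear (q : ℂ) : PSeries →ₗ[ℂ] PSeries where
  -- The coordinates read finitely many coefficients in each degree, so the formula makes sense for
  -- every power series; it has the intended meaning on `QSym`.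
  toFun f := fun d => ∑ I, fundamentalCoord d.degree f I *
    MvPowerSeries.coeff d (fundamental q d.degree I)
  map_add' f g := by
    funext d
    simp only [map_add, Pi.add_apply, add_mul, Finset.sum_add_distrib]
    rfl
  map_smul' c f := by
    funext d
    simp only [map_smul, Pi.smul_apply, smul_eq_mul, mul_assoc, ← Finset.mul_sum]
    rfl

theorem coeff_thetaLinear (q : ℂ) (f : PSeries) (d : ℕ+ →₀ ℕ) :
    MvPowerSeries.coeff d (thetaLinear q f) = ∑ I, fundamentalCoord d.degree f I *
      MvPowerSeries.coeff d (fundamental q d.degree I) := rfl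

theorem thetaLinear_fundamental (q : ℂ) (n : ℕ) (I : Finset (Fin (n - 1))) :
    thetaLinear q (fundamental 0 n I) = fundamental q n I := by
  ext d
  rw [coeff_thetaLinear]
  by_cases h : d.degree = n
  · subst h
    rw [fundamentalCoord_fundamental]
    simp [Pi.single_apply]
  · rw [coeff_fundamental_of_degree_ne q n I d h, fundamentalCoord_eq_zero]
    · simp
    · intro e he
      exact coeff_fundamental_of_degree_ne 0 n I e (he ▸ h)

theorem thetaLinear_permFundamental (q : ℂ) {n : ℕ} (π : Equiv.Perm (Fin n)) :
    thetaLinear q (permFundamental 0 π) = permFundamental q π := by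
  rw [permFundamental_eq_fundamental, thetaLinear_fundamental, permFundamental_eq_fundamental]

/-- Both sides come from quasisymmetric functions, so `d` may be replaced by the standard exponent
with the same rises, where the identity is the inversion formula. -/
theorem coeff_eq_sum_fundamentalCoord {f : PSeries} (hf : IsQuasisymmetric f) (d : ℕ+ →₀ ℕ) :
    MvPowerSeries.coeff d f = ∑ I, fundamentalCoord d.degree f I *
      MvPowerSeries.coeff d (fundamental 0 d.degree I) := by
  classical
  obtain ⟨w, hw, hd⟩ := exists_monotone_content (n := d.degree) d rfl
  let J : Finset (Fin (d.degree - 1)) := {i | w (pos i) < w (nextPos i)}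
  have hJ : ∀ i, w (pos i) < w (nextPos i) ↔ i ∈ J := by simp [J]
  have h1 : ∀ g : PSeries, IsQuasisymmetric g → MvPowerSeries.coeff d g =
      MvPowerSeries.coeff (stdExponent d.degree J) g := by
    intro g hg
    conv_lhs => rw [← hd]
    exact hg.coeff_eq_of_monotone hw (monotone_stdWord _ J) fun i => by
      rw [hJ, stdWord_lt_iff]
  rw [h1 f hf, ← sum_fundamentalCoord]
  simp only [h1 _ (fundamental_mem_qsym 0 _ _).2, coeff_stdExponent_fundamental_zero]
  simp only [mul_ite, mul_one, mul_zero, ← Finset.sum_filter]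
  refine Finset.sum_congr ?_ fun _ _ => rfl
  ext I
  simp

/-- The functions `L_{n,I}^{(0)}` span `QSym`. -/
theorem mem_span_fundamentals_zero {f : PSeries} (hf : f ∈ QSym) :
    f ∈ Submodule.span ℂ (fundamentals 0) := by
  obtain ⟨⟨N, hN⟩, hq⟩ := hf
  -- Bounded degree makes the expansion a finite sum.
  have h : f = ∑ n ∈ range (N + 1), ∑ I, fundamentalCoord n f I • fundamental 0 n I := by
    ext d
    simp only [map_sum, map_smul, smul_eq_mul]
    by_cases hd : d.degree ∈ range (N + 1)
    · rw [Finset.sum_eq_single d.degree]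
      · exact coeff_eq_sum_fundamentalCoord hq d
      · intro n _ hn
        refine Finset.sum_eq_zero fun I _ => ?_
        rw [coeff_fundamental_of_degree_ne 0 n I d hn.symm, mul_zero]
      · exact fun h => absurd hd h
    · rw [Finset.sum_eq_zero]
      · by_contra h0
        exact hd (mem_range.2 (Nat.lt_succ_of_le (hN d h0)))
      · intro n hn
        refine Finset.sum_eq_zero fun I _ => ?_
        rw [coeff_fundamental_of_degree_ne 0 n I d (fun h => hd (h ▸ hn)), mul_zero]
  rw [h]
  exact Submodule.sum_mem _ fun n _ => Submodule.sum_mem _ fun I _ =>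
    Submodule.smul_mem _ _ (Submodule.subset_span ⟨n, I, rfl⟩)

theorem thetaLinear_mem (q : ℂ) {f : PSeries} (hf : f ∈ QSym) :
    thetaLinear q f ∈ fundamentalAlgebra q := by
  replace hf := mem_span_fundamentals_zero hf
  induction hf using Submodule.span_induction with
  | mem x hx =>
    obtain ⟨n, I, rfl⟩ := hx
    rw [thetaLinear_fundamental]
    exact fundamental_mem q n I
  | zero => rw [map_zero]; exact zero_mem _
  | add x y _ _ hx hy => rw [map_add]; exact add_mem hx hy
  | smul c x _ hx => rw [map_smul]; exact Subalgebra.smul_mem _ hx c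

/-- By bilinearity it suffices to treat fundamental functions, whose product formula has the same
shuffles for `0` and for `q`. -/
theorem thetaLinear_mul (q : ℂ) {f g : PSeries} (hf : f ∈ QSym) (hg : g ∈ QSym) :
    thetaLinear q (f * g) = thetaLinear q f * thetaLinear q g := by
  classical
  replace hf := mem_span_fundamentals_zero hf
  replace hg := mem_span_fundamentals_zero hg
  induction hf using Submodule.span_induction with
  | mem x hx =>
    induction hg using Submodule.span_induction with
    | mem y hy =>
      obtain ⟨n, I, rfl⟩ := hx
      obtain ⟨m, J, rfl⟩ := hy
      rw [fundamental, fundamental, permFundamental_mul, map_sum]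
      simp only [thetaLinear_permFundamental]
      rw [permFundamental_mul]
    | zero => simp
    | add y z _ _ h1 h2 => rw [mul_add, map_add, map_add, mul_add, h1, h2]
    | smul c y _ h => rw [mul_smul_comm, map_smul, map_smul, mul_smul_comm, h]
  | zero => simp
  | add y z _ _ h1 h2 => rw [add_mul, map_add, map_add, add_mul, h1, h2]
  | smul c y _ h => rw [smul_mul_assoc, map_smul, map_smul, smul_mul_assoc, h]

theorem thetaLinear_one (q : ℂ) : thetaLinear q 1 = 1 := by
  conv_lhs => rw [← fundamental_zero_empty 0]
  rw [thetaLinear_fundamental, fundamental_zero_empty]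

/-- The homomorphism `Θ_q : QSym → 𝒫^{(q)}`. -/
def thetaHom (q : ℂ) : QSym →ₐ[ℂ] fundamentalAlgebra q :=
  AlgHom.ofLinearMap
    ((thetaLinear q ∘ₗ QSym.val.toLinearMap).codRestrict
      (Subalgebra.toSubmodule (fundamentalAlgebra q)) fun f => thetaLinear_mem q f.2)
    (Subtype.ext (thetaLinear_one q))
    fun f g => Subtype.ext (thetaLinear_mul q f.2 g.2)

/-! Generators of the algebra of symmetric functions -/

open Classical in
/-- The elementary symmetric function `e_n`. -/
def esymmSeries (n : ℕ) : PSeries := fun d => if d.degree = n ∧ ∀ x, d x ≤ 1 then 1 else 0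

open Classical in
theorem coeff_esymmSeries (n : ℕ) (d : ℕ+ →₀ ℕ) :
    MvPowerSeries.coeff d (esymmSeries n) = if d.degree = n ∧ ∀ x, d x ≤ 1 then 1 else 0 := rfl

theorem sum_single_one_apply {α : Type*} [DecidableEq α] (t : Finset α) (x : α) :
    (∑ i ∈ t, Finsupp.single i 1 : α →₀ ℕ) x = if x ∈ t then 1 else 0 := by
  simp [Finsupp.finsetSum_apply, Finsupp.single_apply]

theorem sum_single_one_eq_iff {α : Type*} [DecidableEq α] (t : Finset α) (d : α →₀ ℕ) :
    ∑ i ∈ t, Finsupp.single i 1 = d ↔ t = d.support ∧ ∀ x, d x ≤ 1 := by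
  constructor
  · rintro rfl
    refine ⟨?_, fun x => ?_⟩
    · ext x
      rw [Finsupp.mem_support_iff, sum_single_one_apply]
      split_ifs with h <;> simp [h]
    · rw [sum_single_one_apply]
      split_ifs <;> simp
  · rintro ⟨rfl, h⟩
    ext x
    rw [sum_single_one_apply]
    have := h x
    split_ifs with hx <;> rw [Finsupp.mem_support_iff] at hx <;> omega

theorem degree_sum_single_one {α : Type*} (t : Finset α) :
    (∑ i ∈ t, Finsupp.single i 1 : α →₀ ℕ).degree = #t := by
  simp [map_sum]

theorem coeff_esymm {k : ℕ} (n : ℕ) (d : Fin k →₀ ℕ) :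
    (MvPolynomial.esymm (Fin k) ℂ n).coeff d = if d.degree = n ∧ ∀ x, d x ≤ 1 then 1 else 0 := by
  rw [MvPolynomial.esymm_eq_sum_monomial, MvPolynomial.coeff_sum]
  simp only [MvPolynomial.coeff_monomial]
  split_ifs with h
  · have h1 := (sum_single_one_eq_iff d.support d).2 ⟨rfl, h.2⟩
    rw [Finset.sum_eq_single d.support, if_pos h1]
    · intro t _ ht
      exact if_neg fun h2 => ht ((sum_single_one_eq_iff t d).1 h2).1
    · intro hd
      exfalso; apply hd
      rw [mem_powersetCard, ← degree_sum_single_one, h1]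
      exact ⟨subset_univ _, h.1⟩
  · refine Finset.sum_eq_zero fun t ht => if_neg fun h2 => h ⟨?_, ?_⟩
    · rw [← h2, degree_sum_single_one, (mem_powersetCard.1 ht).2]
    · exact ((sum_single_one_eq_iff t d).1 h2).2

/-- This connects the power series with the fundamental theorem on symmetric polynomials in `k`
variables. -/
theorem killCompl_esymmSeries (k n : ℕ) :
    MvPowerSeries.killCompl (R := ℂ) (firstVars k) (esymmSeries n) =
      (MvPolynomial.esymm (Fin k) ℂ n : MvPowerSeries (Fin k) ℂ) := by
  classical
  ext d
  rw [MvPowerSeries.coeff_killCompl, MvPolynomial.coeff_coe, coeff_esymm, coeff_esymmSeries]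
  refine if_congr (and_congr ?_ ?_) rfl rfl
  · rw [Finsupp.embDomain_eq_mapDomain, Finsupp.degree_mapDomain]
  · constructor
    · intro h x
      have := h (firstVars k x)
      rwa [Finsupp.embDomain_apply_self] at this
    · intro h x
      by_cases hx : x ∈ Set.range (firstVars k)
      · obtain ⟨y, rfl⟩ := hx
        rw [Finsupp.embDomain_apply_self]
        exact h y
      · rw [Finsupp.embDomain_of_notMem_range _ _ _ hx]
        exact zero_le_one

/-- The relation between the elementary and the complete homogeneous symmetric functions. -/
theorem sum_esymmSeries_mul_hsymm (n : ℕ) (hn : 0 < n) :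
    ∑ i ∈ range (n + 1), (-1 : ℂ) ^ i • (esymmSeries i * hsymm (n - i)) = 0 := by
  classical
  ext d
  simp only [map_sum, map_smul, smul_eq_mul, MvPowerSeries.coeff_mul, Finset.mul_sum, map_zero]
  rw [Finset.sum_comm]
  by_cases hd : d.degree = n
  · have h1 : ∀ x ∈ antidiagonal d, ∑ i ∈ range (n + 1), (-1 : ℂ) ^ i *
        (MvPowerSeries.coeff x.1 (esymmSeries i) * MvPowerSeries.coeff x.2 (hsymm (n - i))) =
        if ∀ y, x.1 y ≤ 1 then (-1) ^ x.1.degree else 0 := by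
      intro x hx
      rw [HasAntidiagonal.mem_antidiagonal] at hx
      have h2 : x.1.degree + x.2.degree = n := by rw [← map_add, hx, hd]
      rw [Finset.sum_eq_single x.1.degree]
      · rw [coeff_esymmSeries, coeff_hsymm, if_pos (by omega : x.2.degree = n - x.1.degree)]
        simp
      · intro i _ hi
        rw [coeff_esymmSeries, if_neg fun h => hi h.1.symm, zero_mul, mul_zero]
      · intro h
        exact absurd (mem_range.2 (by omega)) h
    rw [Finset.sum_congr rfl h1, ← Finset.sum_filter]
    have hne : d.support.Nonempty := by
      rw [Finsupp.support_nonempty_iff]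
      rintro rfl
      rw [map_zero] at hd
      omega
    have h3 : ∑ t ∈ d.support.powerset, (-1 : ℂ) ^ #t = 0 := by
      exact_mod_cast congrArg (Int.cast : ℤ → ℂ)
        (Finset.sum_powerset_neg_one_pow_card_of_nonempty hne)
    rw [← h3]
    -- Squarefree divisors of the monomial correspond to subsets of its support; the alternating sum
    -- over subsets of a nonempty set is zero.
    refine Finset.sum_bij' (fun x _ => x.1.support)
      (fun t _ => (∑ i ∈ t, Finsupp.single i 1, d - ∑ i ∈ t, Finsupp.single i 1)) ?_ ?_ ?_ ?_ ?_
    · rintro ⟨a, b⟩ h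
      rw [mem_filter, HasAntidiagonal.mem_antidiagonal] at h
      rw [mem_powerset, ← h.1]
      exact Finsupp.support_mono le_self_add
    · intro t ht
      rw [mem_filter, HasAntidiagonal.mem_antidiagonal]
      refine ⟨add_tsub_cancel_of_le fun x => ?_, ((sum_single_one_eq_iff t _).1 rfl).2⟩
      rw [sum_single_one_apply]
      split_ifs with hx
      · exact Nat.one_le_iff_ne_zero.2 (Finsupp.mem_support_iff.1 (mem_powerset.1 ht hx))
      · exact Nat.zero_le _
    · rintro ⟨a, b⟩ h
      rw [mem_filter, HasAntidiagonal.mem_antidiagonal] at h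
      have h4 := (sum_single_one_eq_iff a.support a).2 ⟨rfl, h.2⟩
      refine Prod.ext h4 ?_
      simp only [h4]
      rw [← h.1]
      exact add_tsub_cancel_left a b
    · intro t ht
      exact ((sum_single_one_eq_iff t _).1 rfl).1.symm
    · rintro ⟨a, b⟩ h
      rw [mem_filter] at h
      have h4 := (sum_single_one_eq_iff a.support a).2 ⟨rfl, h.2⟩
      rw [← degree_sum_single_one a.support, h4]
  · refine Finset.sum_eq_zero fun x hx => Finset.sum_eq_zero fun i hi => ?_
    rw [HasAntidiagonal.mem_antidiagonal] at hx
    rw [coeff_esymmSeries, coeff_hsymm]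
    by_cases h1 : x.1.degree = i
    · rw [if_neg (c := x.2.degree = n - i), mul_zero, mul_zero]
      intro h2
      apply hd
      rw [← hx, map_add, h1, h2]
      have := mem_range.1 hi
      omega
    · rw [if_neg fun h => h1 h.1, zero_mul, mul_zero]

/-- The algebra generated by the complete homogeneous symmetric functions. -/
def hsymmAlgebra : Subalgebra ℂ PSeries := Algebra.adjoin ℂ (Set.range hsymm)

theorem hsymm_mem_hsymmAlgebra (n : ℕ) : hsymm n ∈ hsymmAlgebra := Algebra.subset_adjoin ⟨n, rfl⟩

theorem hsymmAlgebra_le_sym : hsymmAlgebra ≤ Sym :=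
  Algebra.adjoin_le fun _ ⟨n, hn⟩ => hn ▸ hsymm_mem n

theorem hsymm_zero : hsymm 0 = 1 := by
  classical
  ext d
  rw [coeff_hsymm, MvPowerSeries.coeff_one]
  simp [Finsupp.degree_eq_zero_iff]

theorem esymmSeries_zero : esymmSeries 0 = 1 := by
  classical
  ext d
  rw [coeff_esymmSeries, MvPowerSeries.coeff_one]
  refine if_congr ⟨fun h => (Finsupp.degree_eq_zero_iff d).1 h.1, ?_⟩ rfl rfl
  rintro rfl
  simp

/-- Since `h_0 = 1`, the relation between the `e_i` and the `h_j` can be solved recursively for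
`e_n`. -/
theorem esymmSeries_mem (n : ℕ) : esymmSeries n ∈ hsymmAlgebra := by
  induction n using Nat.strong_induction_on with
  | _ n ih =>
    rcases Nat.eq_zero_or_pos n with rfl | hn
    · rw [esymmSeries_zero]
      exact one_mem _
    · have h := sum_esymmSeries_mul_hsymm n hn
      rw [Finset.sum_range_succ, Nat.sub_self, hsymm_zero, mul_one, add_comm] at h
      have h1 : (-1 : ℂ) ^ n • esymmSeries n ∈ hsymmAlgebra := by
        rw [eq_neg_of_add_eq_zero_left h]
        refine neg_mem (sum_mem fun i hi => Subalgebra.smul_mem _ (mul_mem ?_ ?_) _)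
        · exact ih i (mem_range.1 hi)
        · exact hsymm_mem_hsymmAlgebra _
      have h2 := Subalgebra.smul_mem _ h1 ((-1 : ℂ) ^ n)
      rwa [smul_smul, ← mul_pow, neg_one_mul, neg_neg, one_pow, one_smul] at h2

theorem homogeneousComponent_mul (n : ℕ) (f g : PSeries) :
    MvPowerSeries.homogeneousComponent n (f * g) =
      ∑ x ∈ antidiagonal n, MvPowerSeries.homogeneousComponent x.1 f *
        MvPowerSeries.homogeneousComponent x.2 g := by
  ext d
  simp only [map_sum, MvPowerSeries.coeff_homogeneousComponent, MvPowerSeries.coeff_mul]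
  rw [Finset.sum_comm]
  split_ifs with h
  · refine Finset.sum_congr rfl fun a ha => ?_
    rw [HasAntidiagonal.mem_antidiagonal] at ha
    rw [Finset.sum_eq_single (a.1.degree, a.2.degree)]
    · simp
    · rintro ⟨i, j⟩ _ hij
      by_cases h1 : a.1.degree = i
      · by_cases h2 : a.2.degree = j
        · exact absurd (Prod.ext h1.symm h2.symm) hij
        · rw [if_neg h2, mul_zero]
      · rw [if_neg h1, zero_mul]
    · intro h3
      exfalso; apply h3
      rw [HasAntidiagonal.mem_antidiagonal, ← map_add, ha, h]
  · symm
    refine Finset.sum_eq_zero fun a ha => Finset.sum_eq_zero fun x hx => ?_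
    rw [HasAntidiagonal.mem_antidiagonal] at ha hx
    by_cases h1 : a.1.degree = x.1
    · rw [if_neg (c := a.2.degree = x.2), mul_zero]
      intro h2
      exact h (by rw [← ha, map_add, h1, h2, hx])
    · rw [if_neg h1, zero_mul]

/-- The algebra is graded because its generators are homogeneous. This permits cutting off high
degrees without leaving it. -/
theorem homogeneousComponent_mem_hsymmAlgebra {f : PSeries} (hf : f ∈ hsymmAlgebra) (n : ℕ) :
    MvPowerSeries.homogeneousComponent n f ∈ hsymmAlgebra := by
  classical
  induction hf using Algebra.adjoin_induction generalizing n with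
  | mem f hf =>
    obtain ⟨m, rfl⟩ := hf
    have : MvPowerSeries.homogeneousComponent n (hsymm m) = if m = n then hsymm m else 0 := by
      ext d
      rw [MvPowerSeries.coeff_homogeneousComponent]
      split_ifs with h1 h2 h2
      · rfl
      · rw [coeff_hsymm, if_neg fun h => h2 (h.symm.trans h1)]
        simp
      · rw [coeff_hsymm, if_neg fun h => h1 (h.trans h2)]
      · simp
    rw [this]
    split_ifs
    · exact hsymm_mem_hsymmAlgebra m
    · exact zero_mem _
  | algebraMap c =>
    have : MvPowerSeries.homogeneousComponent n (algebraMap ℂ PSeries c) =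
        if n = 0 then algebraMap ℂ PSeries c else 0 := by
      ext d
      rw [MvPowerSeries.coeff_homogeneousComponent]
      have h0 : d.degree ≠ 0 → MvPowerSeries.coeff d (algebraMap ℂ PSeries c) = 0 := by
        intro h
        rw [MvPowerSeries.algebraMap_apply, MvPowerSeries.coeff_C, if_neg]
        rintro rfl
        exact h (map_zero _)
      split_ifs with h1 h2 h2
      · rfl
      · rw [h0 (h1 ▸ h2)]; simp
      · rw [h0 fun h => h1 (h.trans h2.symm)]
      · simp
    rw [this]
    split_ifs
    · exact Subalgebra.algebraMap_mem _ c
    · exact zero_mem _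
  | add f g _ _ hf hg => rw [map_add]; exact add_mem (hf n) (hg n)
  | mul f g _ _ hf hg =>
    rw [homogeneousComponent_mul]
    exact sum_mem fun x _ => mul_mem (hf x.1) (hg x.2)

/-- A coefficient of degree at most `N` of a quasisymmetric function is determined by the
first `N` variables. -/
theorem IsQuasisymmetric.coeff_eq_of_killCompl_eq {f g : PSeries} (hf : IsQuasisymmetric f)
    (hg : IsQuasisymmetric g) {N : ℕ}
    (h : MvPowerSeries.killCompl (R := ℂ) (firstVars N) f =
      MvPowerSeries.killCompl (R := ℂ) (firstVars N) g) {d : ℕ+ →₀ ℕ} (hd : d.degree ≤ N) :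
    MvPowerSeries.coeff d f = MvPowerSeries.coeff d g := by
  rw [isQuasisymmetric_iff] at hf hg
  have hcard : #d.support ≤ N := by
    refine le_trans ?_ hd
    rw [Finsupp.degree_apply, Finset.card_eq_sum_ones]
    exact Finset.sum_le_sum fun x hx => Nat.one_le_iff_ne_zero.2 (Finsupp.mem_support_iff.1 hx)
  -- A support of at most `N` variables is enlarged to exactly `N`; quasisymmetry then transports
  -- these variables to the first `N`.
  obtain ⟨s, hs, hsN⟩ := Infinite.exists_superset_card_eq d.support N hcard
  let e := s.orderEmbOfFin hsN
  obtain ⟨x, hx⟩ : d ∈ Set.range (Finsupp.embDomain (M := ℕ) e.toEmbedding) := by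
    rw [Finsupp.mem_range_embDomain_iff]
    refine (Finset.coe_subset.2 hs).trans ?_
    exact (s.range_orderEmbOfFin hsN).ge
  have h1 := (hf N e.toEmbedding e.strictMono).trans
    (h.trans (hg N e.toEmbedding e.strictMono).symm)
  have h2 := congrArg (MvPowerSeries.coeff x) h1
  rwa [MvPowerSeries.coeff_killCompl, MvPowerSeries.coeff_killCompl, hx] at h2

/-- The algebra of symmetric functions is generated by the complete homogeneous symmetric
functions. -/
theorem hsymmAlgebra_eq_sym : hsymmAlgebra = Sym := by
  classical
  refine le_antisymm hsymmAlgebra_le_sym fun f hf => ?_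
  obtain ⟨N, hN⟩ := hf.1
  -- Since `f` has degree at most `N`, truncating its restriction to the first `N` variables loses
  -- nothing.
  let p : MvPolynomial (Fin N) ℂ :=
    MvPowerSeries.truncTotal (N + 1) (MvPowerSeries.killCompl (R := ℂ) (firstVars N) f)
  have hpc : ∀ d, p.coeff d = MvPowerSeries.coeff (d.mapDomain (firstVars N)) f := by
    intro d
    rw [MvPowerSeries.coeff_truncTotal_eq_ite, MvPowerSeries.coeff_killCompl,
      Finsupp.embDomain_eq_mapDomain]
    split_ifs with h
    · rfl
    · by_contra h0
      have := hN _ (Ne.symm h0)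
      rw [Finsupp.degree_mapDomain] at this
      omega
  have hpf : (p : MvPowerSeries (Fin N) ℂ) = MvPowerSeries.killCompl (R := ℂ) (firstVars N) f := by
    ext d
    rw [MvPolynomial.coeff_coe, hpc, MvPowerSeries.coeff_killCompl, Finsupp.embDomain_eq_mapDomain]
  have hps : p.IsSymmetric := by
    intro e
    ext d
    obtain ⟨c, rfl⟩ : ∃ c : Fin N →₀ ℕ, c.mapDomain e = d :=
      ⟨d.mapDomain e.symm, by rw [← Finsupp.mapDomain_comp]; simp⟩
    -- A permutation of the first `N` variables is extended to all variables by fixing the others,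
    -- so that the symmetry of `f` applies.
    rw [MvPolynomial.coeff_rename_mapDomain _ e.injective, hpc, hpc,
      ← hf.2 (e.viaEmbedding (firstVars N)), ← Finsupp.mapDomain_comp, ← Finsupp.mapDomain_comp]
    have h1 : e.viaEmbedding (firstVars N) ∘ firstVars N = firstVars N ∘ e :=
      funext fun x => e.viaEmbedding_apply (firstVars N) x
    rw [h1]
  obtain ⟨g, hg⟩ := MvPolynomial.esymmAlgHom_fin_surjective (m := N) (n := N) ℂ le_rfl ⟨p, hps⟩
  have hg' : MvPolynomial.aeval (fun i : Fin N => MvPolynomial.esymm (Fin N) ℂ (i + 1)) g = p := by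
    rw [← MvPolynomial.esymmAlgHom_apply, hg]
  -- The polynomial in the `e_i` that expresses `p` is lifted to infinitely many variables; `F` and
  -- `f` then agree in the first `N` variables.
  let F : PSeries := MvPolynomial.aeval (fun i : Fin N => esymmSeries (i + 1)) g
  have hF : F ∈ hsymmAlgebra := by
    have h1 : F ∈ Algebra.adjoin ℂ (Set.range fun i : Fin N => esymmSeries (i + 1)) := by
      rw [Algebra.adjoin_range_eq_range_aeval]
      exact ⟨g, rfl⟩
    refine Algebra.adjoin_le ?_ h1
    rintro _ ⟨i, rfl⟩
    exact esymmSeries_mem _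
  have hkill : MvPowerSeries.killCompl (R := ℂ) (firstVars N) F =
      MvPowerSeries.killCompl (R := ℂ) (firstVars N) f := by
    rw [← hpf, ← hg', MvPolynomial.comp_aeval_apply]
    have h1 := MvPolynomial.comp_aeval_apply (R := ℂ)
      (fun i : Fin N => MvPolynomial.esymm (Fin N) ℂ (i + 1))
      (MvPolynomial.coeToMvPowerSeries.algHom (σ := Fin N) (R := ℂ) ℂ) g
    simp only [MvPolynomial.coeToMvPowerSeries.algHom_apply, Algebra.algebraMap_self,
      MvPowerSeries.map_id, RingHom.id_apply] at h1
    rw [h1]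
    simp only [killCompl_esymmSeries]
  -- Agreement in `N` variables determines the coefficients of degree at most `N`. Cutting `F` off
  -- there makes any bound on its degree unnecessary.
  have hfF : f = ∑ n ∈ range (N + 1), MvPowerSeries.homogeneousComponent n F := by
    ext d
    simp only [map_sum, MvPowerSeries.coeff_homogeneousComponent, Finset.sum_ite_eq, mem_range]
    split_ifs with hd
    · exact (sym_le_qsym hf).2.coeff_eq_of_killCompl_eq
        (sym_le_qsym (hsymmAlgebra_le_sym hF)).2 hkill.symm (Nat.le_of_lt_succ hd)
    · by_contra h0
      exact hd (Nat.lt_succ_of_le (hN d h0))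
  rw [hfF]
  exact sum_mem fun n _ => homogeneousComponent_mem_hsymmAlgebra hF n

/-! The restriction to symmetric functions -/

theorem thetaLinear_hsymm (q : ℂ) (n : ℕ) :
    thetaLinear q (hsymm n) = hallLittlewoodQ (-q) n := by
  rw [← fundamental_zero_eq_hsymm, thetaLinear_fundamental, fundamental_empty]

theorem thetaLinear_mem_hallLittlewoodAlgebra (q : ℂ) {f : PSeries} (hf : f ∈ Sym) :
    thetaLinear q f ∈ hallLittlewoodAlgebra (-q) := by
  -- The preimage of `Λ_{-q}` under `Θ_q` is a subalgebra, so it is enough that it contains the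
  -- generators `h_n` of `Λ`.
  let A : Subalgebra ℂ QSym :=
    ((hallLittlewoodAlgebra (-q)).comap (fundamentalAlgebra q).val).comap (thetaHom q)
  have hA : hsymmAlgebra ≤ A.map QSym.val := by
    refine Algebra.adjoin_le ?_
    rintro _ ⟨n, rfl⟩
    refine ⟨⟨hsymm n, sym_le_qsym (hsymm_mem n)⟩, ?_, rfl⟩
    change thetaLinear q (hsymm n) ∈ hallLittlewoodAlgebra (-q)
    rw [thetaLinear_hsymm]
    exact Algebra.subset_adjoin ⟨n, rfl⟩
  rw [← hsymmAlgebra_eq_sym] at hf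
  obtain ⟨g, hg, rfl⟩ := hA hf
  exact hg

theorem hallLittlewoodAlgebra_le (q : ℂ) : hallLittlewoodAlgebra (-q) ≤ fundamentalAlgebra q := by
  refine Algebra.adjoin_le ?_
  rintro _ ⟨n, rfl⟩
  rw [← fundamental_empty]
  exact fundamental_mem q n ∅

/-- The homomorphism `θ_{-q} : Λ → Λ_{-q}`. -/
def thetaSym (q : ℂ) : Sym →ₐ[ℂ] hallLittlewoodAlgebra (-q) :=
  AlgHom.codRestrict
    ((fundamentalAlgebra q).val.comp ((thetaHom q).comp (Subalgebra.inclusion sym_le_qsym)))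
    (hallLittlewoodAlgebra (-q)) fun f => thetaLinear_mem_hallLittlewoodAlgebra q f.2

/-- The equalizer of the two homomorphisms is a subalgebra containing all `h_n`, and these generate
`Λ`. -/
theorem IsTheta.unique {t : ℂ} {θ θ' : Sym →ₐ[ℂ] hallLittlewoodAlgebra t} (h : IsTheta t θ)
    (h' : IsTheta t θ') : θ = θ' := by
  have hle : hsymmAlgebra ≤ (AlgHom.equalizer θ θ').map Sym.val := by
    refine Algebra.adjoin_le ?_
    rintro _ ⟨n, rfl⟩
    exact ⟨⟨hsymm n, hsymm_mem n⟩, Subtype.ext ((h n).trans (h' n).symm), rfl⟩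
  ext f : 1
  have hf : (f : PSeries) ∈ hsymmAlgebra := hsymmAlgebra_eq_sym.ge f.2
  obtain ⟨g, hg, hgf⟩ := hle hf
  rw [← (Subtype.ext hgf : g = f)]
  exact hg

end

end QSymTheta

theorem mainTheorem3 (q : ℂ) :
    -- `L_π^{(q)}` depends only on `n` and on the descent set of `π`
    (∀ (n : ℕ) (π : Equiv.Perm (Fin n)),
      QSymTheta.permFundamental q π = QSymTheta.fundamental q n (QSymTheta.descents π)) ∧
    -- the linear span of the `L_{n,I}^{(q)}` is the subalgebra `𝒫^{(q)}`
    Subalgebra.toSubmodule (QSymTheta.fundamentalAlgebra q) =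
      Submodule.span ℂ (QSymTheta.fundamentals q) ∧
    -- the homomorphism `Θ_q`
    ∃ Θ : QSymTheta.QSym →ₐ[ℂ] QSymTheta.fundamentalAlgebra q,
      (∀ (n : ℕ) (I : Finset (Fin (n - 1))),
        Θ ⟨QSymTheta.fundamental 0 n I, QSymTheta.fundamental_mem_qsym 0 n I⟩ =
          ⟨QSymTheta.fundamental q n I, QSymTheta.fundamental_mem q n I⟩) ∧
      -- `θ_{-q}` is well defined by its values on the `h_n`, and the square commutes
      ∃ θ : QSymTheta.Sym →ₐ[ℂ] QSymTheta.hallLittlewoodAlgebra (-q),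
        (QSymTheta.IsTheta (-q) θ ∧ ∀ θ', QSymTheta.IsTheta (-q) θ' → θ' = θ) ∧
        ∃ h : QSymTheta.hallLittlewoodAlgebra (-q) ≤ QSymTheta.fundamentalAlgebra q,
          Θ.comp (Subalgebra.inclusion QSymTheta.sym_le_qsym) =
            (Subalgebra.inclusion h).comp θ := by
  -- `thetaSym` is the restriction of `thetaHom` with a smaller codomain, so the square commutes by
  -- definition; what remains is the characterisation of `θ_{-q}` by its values on the `h_n`.
  refine ⟨fun n π => QSymTheta.permFundamental_eq_fundamental q π,
    QSymTheta.toSubmodule_fundamentalAlgebra q, QSymTheta.thetaHom q,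
    fun n I => Subtype.ext (QSymTheta.thetaLinear_fundamental q n I), QSymTheta.thetaSym q,
    ?_, QSymTheta.hallLittlewoodAlgebra_le q, rfl⟩
  have h : QSymTheta.IsTheta (-q) (QSymTheta.thetaSym q) :=
    fun n => QSymTheta.thetaLinear_hsymm q n
  exact ⟨h, fun θ' h' => h'.unique h⟩
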